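/- Let $\mathbb F$ be a field, let $\mathcal A^*=\bigoplus_{k=0}^n\mathcal A^k$ be a unital differential graded commutative algebra over $\mathbb F$ (differential $d$ of degree $+1$) whose cohomology $H^*(\mathcal A)$ is finite dimensional, and let $\int\in (H^n(\mathcal A))^\vee$ be such that the pairing on $H^*(\mathcal A)$ given by $\langle\alpha,\beta\rangle=\int\alpha\cdot\beta$ if $|\alpha|+|\beta|=n$, and $0$ otherwise, is non-degenerate (a Poincaré DGCA of degree $n$). Equip $\mathcal A^*$ with the (possibly degenerate) pairing $\langle x,y\rangle=\int[x\cdot y]$ if $|x|+|y|=n$, and $0$ otherwise. Let $d^-:\mathcal A^*\to\mathcal A^{*-1}$ be a Hodge homotopy: a linear map with $d^-d^-=0$, $d^-dd^-=d^-$, $dd^-d=d$, $\langle \mathrm{Im}\, d^-,\mathrm{Im}\, d^-\rangle=0$ and $\langle \mathrm{Im}\,\pi,\mathrm{Im}\, d^-\rangle=0$, where $\pi=\mathrm{id}-(dd^-+d^-d)$. Let $\mathcal H^*=\mathrm{Im}\,\pi$ be the harmonic subspace. The operations transferred along $d^-$ are $m_1=0$ and $m_k=\pi\circ\widehat m_k$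 for $k\ge 2$, where $\widehat m_2(x_1,x_2)=x_1x_2$ and, for $k\ge3$ and homogeneous $x_1,\dots,x_k\in\mathcal H^*$, $$\begin{aligned}\widehat m_k(x_1,\dots,x_k)={}&(-1)^{k-1}\,d^-\widehat m_{k-1}(x_1,\dots,x_{k-1})\cdot x_k-(-1)^{k|x_1|}\,x_1\cdot d^-\widehat m_{k-1}(x_2,\dots,x_k)\\&-\sum_{i=2}^{k-2}(-1)^{i+(k-i-1)(|x_1|+\dots+|x_i|)}\,d^-\widehat m_i(x_1,\dots,x_i)\cdot d^-\widehat m_{k-i}(x_{i+1},\dots,x_k).\end{aligned}$$ **Theorem.** The graded vector space $\mathcal H^*$ with the operations $(m_k)_{k\ge1}$ is a minimal unital cyclic $C_\infty$-algebra. Explicitly: 1. (Minimal $C_\infty$-algebra.) $m_1=0$; each $m_k$ is $k$-linear of degree $2-k$; for all $N\geq 1$ and all homogeneous $x_1,\dots,x_N\in\mathcal H^*$, $$\sum_{r+s+t=N,\ s\ge1}(-1)^{r+st+s(|x_1|+\dots+|x_r|)}m_{r+1+t}(x_1,\dots,x_r,m_s(x_{r+1},\dots,x_{r+s}),x_{r+s+1},\dots,x_N)=0;$$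 and for all $a,b\ge1$ the operation $m_{a+b}$ vanishes on the sum of all $(a,b)$-shuffles of $x_1,\dots,x_{a+b}$, each shuffle being weighted by its signature times its Koszul sign. 2. (Unital.) The unit $1$ of $\mathcal A^*$ lies in $\mathcal H^0$, $m_2(1,x)=m_2(x,1)=x$ for all $x\in\mathcal H^*$, and for $k\ge3$ the operation $m_k$ vanishes as soon as one of its arguments is $1$. 3. (Cyclic.) The restriction of $\langle-,-\rangle$ to $\mathcal H^*$ is non-degenerate and graded symmetric, it vanishes on pairs of degrees $p,q$ with $p+q\ne n$, and for all $k\ge1$ and all homogeneous $x_1,\dots,x_{k+1}\in\mathcal H^*$, $$\langle m_k(x_1,\dots,x_k),x_{k+1}\rangle=(-1)^k(-1)^{\epsilon}\langle m_k(x_2,\dots,x_{k+1}),x_1\rangle,\qquad \epsilon=|x_1|(|x_2|+\dots+|x_{k+1}|).$$ -/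

import Mathlib

noncomputable section

namespace HodgeTransfer

universe u v

section DGCA

variable {F : Type u} [Field F] {A : Type v} [Ring A] [Algebra F A]

/-- A differential graded commutative algebra structure on the graded (unital, associative)
`F`-algebra `A = ⨁ k, 𝒜 k`. -/
structure DGCA (𝒜 : ℤ → Submodule F A) [GradedAlgebra 𝒜] where
  /-- the differential -/
  d : A →ₗ[F] A
  d_mem : ∀ (k : ℤ) (x : A), x ∈ 𝒜 k → d x ∈ 𝒜 (k + 1)
  d_d : ∀ x : A, d (d x) = 0
  leibniz : ∀ (k : ℤ) (x y : A), x ∈ 𝒜 k → d (x * y) = d x * y + (-1 : F) ^ k • (x * d y)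
  graded_comm : ∀ (k l : ℤ) (x y : A), x ∈ 𝒜 k → y ∈ 𝒜 l → x * y = (-1 : F) ^ (k * l) • (y * x)

/-- The linear map `A → A` that multiplies an element of degree `k` by `(-1) ^ (e * k)`. -/
def signTwist (𝒜 : ℤ → Submodule F A) [GradedAlgebra 𝒜] (e : ℤ) : A →ₗ[F] A :=
  (DirectSum.toModule F ℤ A fun k => (-1 : F) ^ (e * k) • (𝒜 k).subtype) ∘ₗ
    (DirectSum.decomposeLinearEquiv 𝒜).toLinearMap

theorem signTwist_apply (𝒜 : ℤ → Submodule F A) [GradedAlgebra 𝒜] (e k : ℤ) (x : A)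
    (hx : x ∈ 𝒜 k) : signTwist 𝒜 e x = (-1 : F) ^ (e * k) • x := by
  have h : DirectSum.decompose 𝒜 x = DirectSum.of (fun i => 𝒜 i) k ⟨x, hx⟩ :=
    DirectSum.decompose_of_mem 𝒜 hx
  simp only [signTwist, LinearMap.comp_apply, LinearEquiv.coe_coe,
    DirectSum.decomposeLinearEquiv_apply, h]
  rw [← DirectSum.lof_eq_of F, DirectSum.toModule_lof]
  rfl

namespace DGCA

variable {𝒜 : ℤ → Submodule F A} [GradedAlgebra 𝒜] (C : DGCA 𝒜)

/-- The cocycles. -/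
abbrev cocycles : Submodule F A := LinearMap.ker C.d

/-- The coboundaries, as a subspace of the cocycles. -/
abbrev coboundaries : Submodule F C.cocycles := (LinearMap.range C.d).submoduleOf C.cocycles

/-- The cohomology `H^*(A) = ker d / im d`. -/
abbrev cohomology : Type v := C.cocycles ⧸ C.coboundaries

/-- The degree `k` part `H^k(A)`: the classes of the cocycles of degree `k`. -/
def cohomologyPiece (k : ℤ) : Submodule F C.cohomology :=
  ((𝒜 k).submoduleOf C.cocycles).map C.coboundaries.mkQ

theorem d_mul_of_closed (x y : A) (hy : C.d y = 0) : C.d (x * y) = C.d x * y := by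
  induction x using DirectSum.Decomposition.inductionOn 𝒜 with
  | zero => simp
  | homogeneous m => rw [C.leibniz _ _ _ m.2, hy]; simp
  | add a b ha hb => rw [add_mul, map_add, ha, hb, map_add, add_mul]

theorem d_signTwist (x : A) : C.d (signTwist 𝒜 1 x) = - signTwist 𝒜 1 (C.d x) := by
  induction x using DirectSum.Decomposition.inductionOn 𝒜 with
  | zero => simp
  | @homogeneous i m =>
    rw [signTwist_apply 𝒜 1 i _ m.2, signTwist_apply 𝒜 1 (i + 1) _ (C.d_mem _ _ m.2), map_smul,
      one_mul, one_mul, zpow_add_one₀ (by simp)]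
    simp
  | add a b ha hb => simp only [map_add, ha, hb]; abel

theorem d_signTwist_mul (x y : A) :
    C.d (signTwist 𝒜 1 x * y) = C.d (signTwist 𝒜 1 x) * y + x * C.d y := by
  induction x using DirectSum.Decomposition.inductionOn 𝒜 with
  | zero => simp
  | @homogeneous i m =>
    rw [signTwist_apply 𝒜 1 i _ m.2, C.leibniz i _ _ ((𝒜 i).smul_mem _ m.2), one_mul, smul_mul_assoc,
      smul_smul, ← mul_zpow]
    simp
  | add a b ha hb => simp only [map_add, add_mul, ha, hb]; abel

/-- The product of two cocycles. -/
def cocycleMul : C.cocycles →ₗ[F] C.cocycles →ₗ[F] C.cocycles :=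
  LinearMap.mk₂ F
    (fun x y => ⟨(x : A) * (y : A), by
      have hx : C.d x = 0 := x.2
      rw [LinearMap.mem_ker, C.d_mul_of_closed _ _ y.2, hx, zero_mul]⟩)
    (fun _ _ _ => Subtype.ext (add_mul _ _ _))
    (fun _ _ _ => Subtype.ext (smul_mul_assoc _ _ _))
    (fun _ _ _ => Subtype.ext (mul_add _ _ _))
    (fun _ _ _ => Subtype.ext (mul_smul_comm _ _ _))

theorem cocycleMul_left (b z : C.cocycles) (hb : b ∈ C.coboundaries) :
    C.cocycleMul b z ∈ C.coboundaries := by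
  obtain ⟨w, hw⟩ := hb
  refine ⟨w * z, ?_⟩
  rw [C.d_mul_of_closed _ _ z.2, hw]
  rfl

theorem cocycleMul_right (z b : C.cocycles) (hb : b ∈ C.coboundaries) :
    C.cocycleMul z b ∈ C.coboundaries := by
  obtain ⟨w, hw⟩ := hb
  refine ⟨signTwist 𝒜 1 z * w, ?_⟩
  have hz : C.d z = 0 := z.2
  rw [C.d_signTwist_mul, C.d_signTwist, hz, hw]
  simp [cocycleMul]

/-- The product of a cohomology class and the class of a cocycle. -/
def cupAux : C.cocycles →ₗ[F] C.cohomology →ₗ[F] C.cohomology :=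
  (C.coboundaries.liftQ (C.cocycleMul.compr₂ C.coboundaries.mkQ).flip (by
    intro b hb
    rw [LinearMap.mem_ker]
    ext z
    exact (Submodule.Quotient.mk_eq_zero _).2 (C.cocycleMul_right z b hb))).flip

/-- The cup product on cohomology: `[x] ∪ [y] = [x * y]`. -/
def cup : C.cohomology →ₗ[F] C.cohomology →ₗ[F] C.cohomology :=
  C.coboundaries.liftQ C.cupAux (by
    intro b hb
    rw [LinearMap.mem_ker]
    ext z
    exact (Submodule.Quotient.mk_eq_zero _).2 (C.cocycleMul_left b z hb))

theorem cup_mk (x y : C.cocycles) :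
    C.cup (C.coboundaries.mkQ x) (C.coboundaries.mkQ y) = C.coboundaries.mkQ (C.cocycleMul x y) :=
  rfl

end DGCA

/-- A Poincaré DGCA of degree `n`: a DGCA concentrated in degrees `0, …, n` with finite dimensional
cohomology and a fundamental class `∫`, a linear functional on `H^n` (here extended by zero to the
other degrees), such that the pairing `(α, β) ↦ ∫ (α ∪ β)` on cohomology is nondegenerate. -/
structure PDGCA (𝒜 : ℤ → Submodule F A) [GradedAlgebra 𝒜] (n : ℕ) extends DGCA 𝒜 where
  bounded : ∀ k : ℤ, (k < 0 ∨ (n : ℤ) < k) → 𝒜 k = ⊥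
  finite_cohomology : FiniteDimensional F toDGCA.cohomology
  /-- the fundamental class -/
  fund : Module.Dual F toDGCA.cohomology
  fund_eq_zero : ∀ k : ℤ, k ≠ n → ∀ α ∈ toDGCA.cohomologyPiece k, fund α = 0
  nondegenerate : ∀ α : toDGCA.cohomology,
    (∀ β : toDGCA.cohomology, fund (toDGCA.cup α β) = 0) → α = 0

namespace PDGCA

variable {𝒜 : ℤ → Submodule F A} [GradedAlgebra 𝒜] {n : ℕ} (P : PDGCA 𝒜 n)

/-- The degree `n` component of an element; it is a cocycle since `A` vanishes in degree `n + 1`. -/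
def topCocycle : A →ₗ[F] P.cocycles :=
  (GradedAlgebra.proj 𝒜 (n : ℤ)).codRestrict P.cocycles (fun x => by
    have h := P.d_mem n _ (SetLike.coe_mem (DirectSum.decompose 𝒜 x (n : ℤ)))
    rw [P.bounded (n + 1) (Or.inr (by omega))] at h
    exact h)

/-- The pairing on `A`: for `x`, `y` of complementary degrees it is `∫ [x * y]`, where
`[·] : A^n → H^n` is the projection; for `x`, `y` of other degrees it is zero. -/
def pairing : A →ₗ[F] A →ₗ[F] F :=
  (LinearMap.mul F A).compr₂ (P.fund ∘ₗ P.coboundaries.mkQ ∘ₗ P.topCocycle)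

end PDGCA

/-- A Hodge homotopy for a Poincaré DGCA. The last field says that the image of
`π = id - (d d⁻ + d⁻ d)` is orthogonal to the image of `d⁻`. -/
structure HodgeHomotopy {𝒜 : ℤ → Submodule F A} [GradedAlgebra 𝒜] {n : ℕ} (P : PDGCA 𝒜 n) where
  /-- the operator `d⁻` -/
  dm : A →ₗ[F] A
  dm_mem : ∀ (k : ℤ) (x : A), x ∈ 𝒜 k → dm x ∈ 𝒜 (k - 1)
  dm_dm : ∀ x : A, dm (dm x) = 0
  dm_d_dm : ∀ x : A, dm (P.d (dm x)) = dm x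
  d_dm_d : ∀ x : A, P.d (dm (P.d x)) = P.d x
  orth_dm : ∀ x y : A, P.pairing (dm x) (dm y) = 0
  orth_proj : ∀ x y : A, P.pairing (x - (P.d (dm x) + dm (P.d x))) (dm y) = 0

/-- Concatenation product of multilinear maps:
`(f ⌣ g)(x_1, …, x_n) = f(x_1, …, x_a) * g(x_{a+1}, …, x_{a+b})`, where `n = a + b`. -/
def concat {a b n : ℕ} (h : a + b = n) (f : MultilinearMap F (fun _ : Fin a => A) A)
    (g : MultilinearMap F (fun _ : Fin b => A) A) : MultilinearMap F (fun _ : Fin n => A) A :=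
  ((LinearMap.mul' F A).compMultilinearMap (f.domCoprod g)).domDomCongr
    (finSumFinEquiv.trans (finCongr h))

theorem concat_apply {a b n : ℕ} (h : a + b = n) (f : MultilinearMap F (fun _ : Fin a => A) A)
    (g : MultilinearMap F (fun _ : Fin b => A) A) (x : Fin n → A) :
    concat h f g x = f (fun i => x ⟨i, by omega⟩) * g (fun j => x ⟨a + j, by omega⟩) := by
  subst h
  rfl

namespace HodgeHomotopy

variable {𝒜 : ℤ → Submodule F A} [GradedAlgebra 𝒜] {n : ℕ} {P : PDGCA 𝒜 n}
  (δ : HodgeHomotopy P)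

/-- The projection `π = id - [d, d⁻]`. -/
def proj : A →ₗ[F] A := LinearMap.id - (P.d ∘ₗ δ.dm + δ.dm ∘ₗ P.d)

/-- The harmonic subspace, the image of `π`. -/
def harmonic : Submodule F A := LinearMap.range δ.proj

/-- The grading of the harmonic subspace. -/
def harmonicGrading (k : ℤ) : Submodule F δ.harmonic := (𝒜 k).submoduleOf δ.harmonic

/-- The operations of the homotopy transfer along `d⁻`, before the projection to the harmonic
subspace: the differential in arity one, the product in arity two and, in arity `k + 3`, the
recursion that `hat_apply` spells out on homogeneous elements. -/
def hat : (k : ℕ) → MultilinearMap F (fun _ : Fin k => A) A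
  | 0 => 0
  | 1 => MultilinearMap.ofSubsingleton F A A 0 P.d
  | 2 => concat (a := 1) (b := 1) rfl
      (MultilinearMap.ofSubsingleton F A A 0 LinearMap.id)
      (MultilinearMap.ofSubsingleton F A A 0 LinearMap.id)
  | k + 3 =>
      (-1 : F) ^ (k + 2) • concat (a := k + 2) (b := 1) rfl
        (δ.dm.compMultilinearMap (hat (k + 2)))
        (MultilinearMap.ofSubsingleton F A A 0 LinearMap.id)
      - concat (a := 1) (b := k + 2) (by omega)
        (MultilinearMap.ofSubsingleton F A A 0 (signTwist 𝒜 (k + 3)))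
        (δ.dm.compMultilinearMap (hat (k + 2)))
      - ∑ i : Fin k, (-1 : F) ^ ((i : ℕ) + 2) •
          concat (a := i + 2) (b := k + 1 - i) (by omega)
            ((δ.dm.compMultilinearMap (hat (i + 2))).compLinearMap
              fun _ => signTwist 𝒜 ((k : ℤ) - i))
            (δ.dm.compMultilinearMap (hat (k + 1 - i)))
  termination_by k => k

theorem hat_two (x : Fin 2 → A) : δ.hat 2 x = x 0 * x 1 := by
  rw [hat, concat_apply]
  rfl

/-- The recursion on homogeneous elements `x_1, …, x_N`, `N = k + 3`, of degrees `p_1, …, p_N`. -/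
theorem hat_apply (k : ℕ) (p : Fin (k + 3) → ℤ) (x : Fin (k + 3) → A) (hx : ∀ i, x i ∈ 𝒜 (p i)) :
    δ.hat (k + 3) x =
      (-1 : F) ^ (k + 2) •
        (δ.dm (δ.hat (k + 2) fun j => x j.castSucc) * x (Fin.last (k + 2)))
      - (-1 : F) ^ (((k : ℤ) + 3) * p 0) • (x 0 * δ.dm (δ.hat (k + 2) fun j => x j.succ))
      - ∑ i : Fin k,
          (-1 : F) ^ (((i : ℤ) + 2) + ((k : ℤ) - i) * ∑ j : Fin (i + 2), p ⟨j, by omega⟩) •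
          (δ.dm (δ.hat (i + 2) fun j => x ⟨j, by omega⟩) *
            δ.dm (δ.hat (k + 1 - i) fun j => x ⟨i + 2 + j, by omega⟩)) := by
  have hne : (-1 : F) ≠ 0 := by simp
  rw [hat]
  simp only [sub_apply, sum_apply, smul_apply,
    concat_apply]
  congr 1
  · congr 1
    have h1 : signTwist 𝒜 ((k : ℤ) + 3) (x 0) = (-1 : F) ^ (((k : ℤ) + 3) * p 0) • x 0 :=
      signTwist_apply 𝒜 _ _ _ (hx 0)
    rw [← smul_mul_assoc, ← h1]
    simp only [MultilinearMap.ofSubsingleton_apply_apply, LinearMap.compMultilinearMap_apply]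
    congr 4
    funext j
    congr 1
    ext
    simp [add_comm]
  · refine Finset.sum_congr rfl fun i _ => ?_
    simp only [MultilinearMap.compLinearMap_apply, LinearMap.compMultilinearMap_apply]
    have h2 : ∀ j : Fin ((i : ℕ) + 2), signTwist 𝒜 ((k : ℤ) - i) (x ⟨j, by omega⟩) =
        (-1 : F) ^ (((k : ℤ) - i) * p ⟨j, by omega⟩) • x ⟨j, by omega⟩ := fun j =>
      signTwist_apply 𝒜 _ _ _ (hx _)
    simp only [h2]
    rw [MultilinearMap.map_smul_univ, map_smul, smul_mul_assoc, smul_smul]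
    congr 1
    rw [zpow_add₀ hne, Finset.mul_sum]
    congr 1
    · norm_cast
    · induction (Finset.univ : Finset (Fin ((i : ℕ) + 2))) using Finset.induction_on with
      | empty => simp
      | insert a s ha ih => rw [Finset.prod_insert ha, Finset.sum_insert ha, zpow_add₀ hne, ih]

/-- The transferred operations `m_k = π ∘ m̂_k` on the harmonic subspace. -/
def m (k : ℕ) : MultilinearMap F (fun _ : Fin k => δ.harmonic) δ.harmonic :=
  δ.proj.rangeRestrict.compMultilinearMap ((δ.hat k).compLinearMap fun _ => δ.harmonic.subtype)

/-- The pairing restricted to the harmonic subspace. -/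
def harmonicPairing : δ.harmonic →ₗ[F] δ.harmonic →ₗ[F] F :=
  P.pairing.compl₁₂ δ.harmonic.subtype δ.harmonic.subtype

end HodgeHomotopy

end DGCA

section Infinity

variable {F : Type u} [Field F] {V : Type v} [AddCommGroup V] [Module F V]

/-- `m` is an A∞-algebra structure on the graded vector space `V = ⨁ k, 𝒱 k`: `m_k` has degree
`2 - k` and, for all `N` and all homogeneous `x_1, …, x_N` of degrees `p_1, …, p_N`,
`∑_{r+s+t=N, s≥1} (-1)^{r + st + s(p_1+⋯+p_r)}
  m_{r+1+t}(x_1, …, x_r, m_s(x_{r+1}, …, x_{r+s}), x_{r+s+1}, …, x_N) = 0`.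
The tuple is written as a sequence `x`, starting at `x 0`, of which the first `N` terms are used. -/
structure IsAInfinityAlgebra (𝒱 : ℤ → Submodule F V)
    (m : (k : ℕ) → MultilinearMap F (fun _ : Fin k => V) V) : Prop where
  internal : DirectSum.IsInternal 𝒱
  m_zero : m 0 = 0
  degree : ∀ (k : ℕ) (p : Fin k → ℤ) (x : Fin k → V), (∀ i, x i ∈ 𝒱 (p i)) →
    m k x ∈ 𝒱 (∑ i, p i + 2 - k)
  relation : ∀ (N : ℕ) (p : ℕ → ℤ) (x : ℕ → V), (∀ i, x i ∈ 𝒱 (p i)) →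
    ∑ s ∈ Finset.Icc 1 N, ∑ r ∈ Finset.range (N - s + 1),
      (-1 : F) ^ ((r : ℤ) + s * ((N : ℤ) - r - s) + s * ∑ i ∈ Finset.range r, p i) •
        m (N - s + 1) (fun i =>
          if (i : ℕ) < r then x i
          else if (i : ℕ) = r then m s (fun a => x (r + a))
          else x (i + s - 1)) = 0

/-- `σ` is an `(a, b)`-shuffle. -/
def IsShuffle (a b : ℕ) (σ : Equiv.Perm (Fin (a + b))) : Prop :=
  StrictMono (fun i : Fin a => σ (Fin.castAdd b i)) ∧
    StrictMono (fun j : Fin b => σ (Fin.natAdd a j))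

/-- The signature of `σ` times the Koszul sign of the permutation that moves the `i`-th of `k`
elements, of degree `p i`, to position `σ i`: each inversion contributes `-(-1)^{p_i p_j}`. -/
def shuffleSign (F : Type u) [Field F] {k : ℕ} (p : Fin k → ℤ) (σ : Equiv.Perm (Fin k)) : F :=
  ∏ ij ∈ Finset.univ.filter (fun ij : Fin k × Fin k => ij.1 < ij.2 ∧ σ ij.2 < σ ij.1),
    (-1 : F) ^ (1 + p ij.1 * p ij.2)

open Classical in
/-- A C∞-algebra: an A∞-algebra whose operations vanish on the signed sum of all
`(a, b)`-shuffles, `a, b ≥ 1`. -/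
structure IsCInfinityAlgebra (𝒱 : ℤ → Submodule F V)
    (m : (k : ℕ) → MultilinearMap F (fun _ : Fin k => V) V) : Prop
    extends IsAInfinityAlgebra 𝒱 m where
  shuffle : ∀ (a b : ℕ), 1 ≤ a → 1 ≤ b → ∀ (p : Fin (a + b) → ℤ) (x : Fin (a + b) → V),
    (∀ i, x i ∈ 𝒱 (p i)) →
    ∑ σ ∈ Finset.univ.filter (fun σ : Equiv.Perm (Fin (a + b)) => IsShuffle a b σ),
      shuffleSign F p σ • m (a + b) (fun i => x (σ.symm i)) = 0

/-- A minimal C∞-algebra: the differential `m_1` vanishes. -/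
structure IsMinimalCInfinityAlgebra (𝒱 : ℤ → Submodule F V)
    (m : (k : ℕ) → MultilinearMap F (fun _ : Fin k => V) V) : Prop
    extends IsCInfinityAlgebra 𝒱 m where
  m_one : m 1 = 0

/-- `e` is a (strict) unit for the operations `m`. -/
structure IsStrictUnit (𝒱 : ℤ → Submodule F V)
    (m : (k : ℕ) → MultilinearMap F (fun _ : Fin k => V) V) (e : V) : Prop where
  mem : e ∈ 𝒱 0
  m_one : m 1 ![e] = 0
  left_unit : ∀ a : V, m 2 ![e, a] = a
  right_unit : ∀ a : V, m 2 ![a, e] = a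
  higher : ∀ (k : ℕ), 3 ≤ k → ∀ x : Fin k → V, (∃ i, x i = e) → m k x = 0

/-- The operations `m` are cyclic with respect to `B`, a nondegenerate graded symmetric pairing of
degree `-n`: for homogeneous `x_1, …, x_{k+1}` of degrees `p_1, …, p_{k+1}`,
`B(m_k(x_1, …, x_k), x_{k+1}) = (-1)^k (-1)^{p_1(p_2+⋯+p_{k+1})} B(m_k(x_2, …, x_{k+1}), x_1)`. -/
structure IsCyclic (𝒱 : ℤ → Submodule F V)
    (m : (k : ℕ) → MultilinearMap F (fun _ : Fin k => V) V) (B : V →ₗ[F] V →ₗ[F] F) (n : ℕ) :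
    Prop where
  degree : ∀ (p q : ℤ) (x y : V), x ∈ 𝒱 p → y ∈ 𝒱 q → p + q ≠ n → B x y = 0
  symm : ∀ (p q : ℤ) (x y : V), x ∈ 𝒱 p → y ∈ 𝒱 q → B x y = (-1 : F) ^ (p * q) * B y x
  nondegenerate : ∀ x : V, (∀ y : V, B x y = 0) → x = 0
  cyclic : ∀ (k : ℕ) (p : Fin (k + 1) → ℤ) (x : Fin (k + 1) → V), (∀ i, x i ∈ 𝒱 (p i)) →
    B (m k fun i => x i.castSucc) (x (Fin.last k)) =
      (-1 : F) ^ k * (-1 : F) ^ (p 0 * ∑ i : Fin k, p i.succ) * B (m k fun i => x i.succ) (x 0)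

end Infinity

end HodgeTransfer

end

/-! Write τ x = (-1)^{|x|} x, and let f * g be the convolution of functions on words over all
factorizations of a word into two. The transfer is encoded by G (`treeWord`) and M = τG * G
(`hatWord`), tied by G = letter + d⁻M (`treeWord_eq`). Up to the sign (-1)^{k + ∑(k-i)p_i}, which
depends only on the degrees of the arguments, M is m̂_k for k ≥ 2 (`hat_eq_hatWord`). This is the
passage to degrees shifted by one. After it the A∞, shuffle and cyclic identities are formal
properties of convolution, and the stated signs are recovered by parity computations.

A∞ relations: on closed letters the Hodge decomposition gives dG = M - (πM + d⁻dM). In d(τG * G) the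
two contributions of M are -(G * τG) * G and G * (τG * G), which cancel by associativity. What
remains is computed by induction on the length: inserting πM into a word is a coderivation, so it
satisfies a Leibniz rule for convolution (`insertSum_conv`), and dM is M evaluated after all such
insertions (`d_hatWord_eq_insertSum`). Applying π and using πd = 0 gives the relations.

Shuffles: deconcatenation is multiplicative for the shuffle product (`shuffleSum_conv`). If G
vanishes on shorter shuffles, then M on a shuffle of u and v reduces to τG(u)G(v) ± τG(v)G(u), which
is zero by graded commutativity. Since G = d⁻M on words of length at least two, the induction
closes.

Cyclicity: d⁻ is selfadjoint up to τ (`pairing_dm_left`), by Stokes and the orthogonality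
conditions. With X(u) = G(xu), Y(v) = G(vy) and T = τG, expand X in X * (T * Y) and Y in (X * T) * Y
by G = letter + d⁻M. Adjointness identifies the integrals of the d⁻ terms, and the remaining terms
are the two sides of the cyclic identity.

Unit: by induction, every term of m̂_k with an argument 1 either contains a factor d⁻m̂_l that
already vanishes, or is 1 times an element of Im d⁻, which both π and d⁻ kill. Nondegeneracy: a
harmonic x orthogonal to the harmonic space pairs to zero with all of cohomology, hence is exact,
and x = πx = 0. -/

namespace HodgeTransfer

/-! ### Words, factorizations and convolution -/

section Words

variable {α β : Type*}

/-- The sum of `K u v` over all factorizations `w = u ++ v` of the word `w`. -/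
def splitSum {M : Type*} [AddCommMonoid M] (K : List α → List α → M) (w : List α) : M :=
  ∑ i ∈ Finset.range (w.length + 1), K (w.take i) (w.drop i)

section splitSum

variable {M : Type*} [AddCommMonoid M]

theorem splitSum_nil (K : List α → List α → M) : splitSum K [] = K [] [] := by
  simp [splitSum]

theorem splitSum_cons (K : List α → List α → M) (a : α) (w : List α) :
    splitSum K (a :: w) = K [] (a :: w) + splitSum (fun u v => K (a :: u) v) w := by
  rw [splitSum, List.length_cons, Finset.sum_range_succ', add_comm]
  simp [splitSum]

theorem splitSum_append_singleton (K : List α → List α → M) (w : List α) (a : α) :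
    splitSum K (w ++ [a]) = splitSum (fun u v => K u (v ++ [a])) w + K (w ++ [a]) [] := by
  induction w generalizing K with
  | nil => simp [splitSum_nil, splitSum_cons]
  | cons c w ih =>
    rw [List.cons_append, splitSum_cons, ih, splitSum_cons, add_assoc]
    rfl

theorem splitSum_add (K L : List α → List α → M) (w : List α) :
    splitSum (fun u v => K u v + L u v) w = splitSum K w + splitSum L w :=
  Finset.sum_add_distrib

theorem splitSum_congr {K L : List α → List α → M} {w : List α}
    (h : ∀ u v, u ++ v = w → K u v = L u v) : splitSum K w = splitSum L w :=
  Finset.sum_congr rfl fun _ _ => h _ _ (List.take_append_drop _ _)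

theorem splitSum_eq_zero {K : List α → List α → M} {w : List α}
    (h : ∀ u v, u ++ v = w → K u v = 0) : splitSum K w = 0 :=
  Finset.sum_eq_zero fun _ _ => h _ _ (List.take_append_drop _ _)

theorem map_splitSum {N : Type*} [AddCommMonoid N] {G : Type*} [FunLike G M N]
    [AddMonoidHomClass G M N] (φ : G) (K : List α → List α → M) (w : List α) :
    φ (splitSum K w) = splitSum (fun u v => φ (K u v)) w :=
  map_sum φ _ _

theorem splitSum_map (f : α → β) (K : List β → List β → M) (w : List α) :
    splitSum K (w.map f) = splitSum (fun u v => K (u.map f) (v.map f)) w := by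
  simp [splitSum, List.map_take, List.map_drop]

theorem splitSum_assoc (K : List α → List α → List α → M) (w : List α) :
    splitSum (fun u v => splitSum (fun u₁ u₂ => K u₁ u₂ v) u) w =
      splitSum (fun u v => splitSum (fun v₁ v₂ => K u v₁ v₂) v) w := by
  induction w generalizing K with
  | nil => simp [splitSum_nil]
  | cons a w ih =>
    rw [splitSum_cons, splitSum_cons _ a w, ← ih]
    simp only [splitSum_cons, splitSum_nil, splitSum_add, add_assoc]

end splitSum

section conv

variable {A : Type*} [Ring A]

/-- The convolution of two functions on words: `(f * g)(w) = ∑_{w = u v} f(u) g(v)`. -/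
def conv (f g : List α → A) (w : List α) : A := splitSum (fun u v => f u * g v) w

theorem conv_nil (f g : List α → A) : conv f g [] = f [] * g [] := splitSum_nil _

theorem conv_cons (f g : List α → A) (a : α) (w : List α) :
    conv f g (a :: w) = f [] * g (a :: w) + conv (fun u => f (a :: u)) g w := splitSum_cons _ _ _

theorem conv_append_singleton (f g : List α → A) (w : List α) (a : α) :
    conv f g (w ++ [a]) = conv f (fun v => g (v ++ [a])) w + f (w ++ [a]) * g [] :=
  splitSum_append_singleton _ _ _

theorem conv_congr {f f' g g' : List α → A} {w : List α}
    (h : ∀ u v, u ++ v = w → f u * g v = f' u * g' v) : conv f g w = conv f' g' w :=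
  splitSum_congr h

theorem conv_add_left (f f' g : List α → A) (w : List α) :
    conv (fun u => f u + f' u) g w = conv f g w + conv f' g w := by
  simp only [conv, add_mul, splitSum_add]

theorem conv_add_right (f g g' : List α → A) (w : List α) :
    conv f (fun u => g u + g' u) w = conv f g w + conv f g' w := by
  simp only [conv, mul_add, splitSum_add]

theorem conv_neg_left (f g : List α → A) (w : List α) :
    conv (fun u => - f u) g w = - conv f g w := by
  simp only [conv, neg_mul, splitSum, Finset.sum_neg_distrib]

theorem conv_neg_right (f g : List α → A) (w : List α) :
    conv f (fun u => - g u) w = - conv f g w := by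
  simp only [conv, mul_neg, splitSum, Finset.sum_neg_distrib]

theorem conv_assoc (f g k : List α → A) (w : List α) :
    conv (conv f g) k w = conv f (conv g k) w := by
  simp only [conv]
  rw [splitSum_congr (L := fun u v => splitSum (fun u₁ u₂ => f u₁ * g u₂ * k v) u)
    (fun u v _ => by simp only [splitSum, Finset.sum_mul]),
    splitSum_assoc (fun u₁ u₂ v => f u₁ * g u₂ * k v)]
  refine splitSum_congr fun u v _ => ?_
  simp only [splitSum, Finset.mul_sum, mul_assoc]

theorem conv_map (φ : α → β) (f g : List β → A) (w : List α) :
    conv f g (w.map φ) = conv (fun u => f (u.map φ)) (fun v => g (v.map φ)) w :=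
  splitSum_map _ _ _

end conv

/-! ### Insertion of an operation into a word, as a coderivation -/

section insertSum

variable {M : Type*} [AddCommMonoid M] (b : List α → α) (θ : α → α)

/-- The sum of `f (θ r ++ [b s] ++ t)` over all factorizations `w = r ++ s ++ t` of the word `w`
with `s` nonempty, where `θ r` arises from `r` by applying `θ` to all letters. -/
def insertSum (f : List α → M) : List α → M
  | [] => 0
  | a :: w => splitSum (fun u v => f (b (a :: u) :: v)) w + insertSum (fun l => f (θ a :: l)) w

theorem insertSum_add (f g : List α → M) (w : List α) :
    insertSum b θ (fun l => f l + g l) w = insertSum b θ f w + insertSum b θ g w := by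
  induction w generalizing f g with
  | nil => simp [insertSum]
  | cons a w ih => simp only [insertSum, splitSum_add, ih]; abel

theorem map_insertSum {N : Type*} [AddCommMonoid N] {G : Type*} [FunLike G M N]
    [AddMonoidHomClass G M N] (φ : G) (f : List α → M) (w : List α) :
    φ (insertSum b θ f w) = insertSum b θ (fun l => φ (f l)) w := by
  induction w generalizing f with
  | nil => simp [insertSum]
  | cons a w ih => simp only [insertSum, map_add, map_splitSum, ih]

/-- Passes from the recursion, which suits induction on the word, to the double sum over s and r in
`IsAInfinityAlgebra.relation`. In the induction step the r = 0 terms form the `splitSum`, and the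
terms with r > 0 have the first letter twisted by θ. -/
theorem insertSum_eq_sum (f : List α → M) (w : List α) :
    insertSum b θ f w = ∑ s ∈ Finset.Icc 1 w.length, ∑ r ∈ Finset.range (w.length - s + 1),
      f ((w.take r).map θ ++ b ((w.drop r).take s) :: w.drop (r + s)) := by
  induction w generalizing f with
  | nil => simp [insertSum]
  | cons a w ih =>
    have key : ∀ s ∈ Finset.Icc 1 (w.length + 1),
        ∑ r ∈ Finset.range (w.length + 1 - s + 1),
          f (((a :: w).take r).map θ ++ b (((a :: w).drop r).take s) :: (a :: w).drop (r + s)) =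
        f (b ((a :: w).take s) :: (a :: w).drop s) +
        ∑ r ∈ Finset.range (w.length + 1 - s),
          f (θ a :: ((w.take r).map θ ++ b ((w.drop r).take s) :: w.drop (r + s))) := by
      intro s _
      rw [Finset.sum_range_succ', add_comm]
      simp [add_right_comm]
    rw [List.length_cons, Finset.sum_congr rfl key, Finset.sum_add_distrib, insertSum, ih]
    congr 1
    · have h := Finset.sum_Ico_add' (fun s => f (b ((a :: w).take s) :: (a :: w).drop s)) 0
        (w.length + 1) 1
      rw [← Finset.range_eq_Ico] at h
      exact h
    · rw [← Finset.insert_Icc_right_eq_Icc_add_one (by omega), Finset.sum_insert (by simp)]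
      simp only [Nat.sub_self, Finset.range_zero, Finset.sum_empty, zero_add]
      refine Finset.sum_congr rfl fun s hs => ?_
      rw [Finset.mem_Icc] at hs
      rw [Nat.sub_add_comm hs.2]

/-- Leibniz rule: when a word with an inserted letter is cut in two, that letter lies in the left or
in the right factor. In the second case the whole left factor precedes it and has been twisted by θ.
-/
theorem insertSum_conv {A : Type*} [Ring A] (f g : List α → A) (w : List α) :
    insertSum b θ (conv f g) w =
      conv (insertSum b θ f) g w + conv (fun u => f (u.map θ)) (insertSum b θ g) w := by
  induction w generalizing f with
  | nil => simp [insertSum, conv_nil]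
  | cons a w ih =>
    have hsmul : ∀ (c : A) (k : List α → A), insertSum b θ (fun l => c * k l) w =
        c * insertSum b θ k w := fun c k =>
      (map_insertSum b θ (AddMonoidHom.mulLeft c) k w).symm
    have h1 : splitSum (fun u v => conv f g (b (a :: u) :: v)) w =
        f [] * splitSum (fun u v => g (b (a :: u) :: v)) w +
        conv (fun u => splitSum (fun u₁ u₂ => f (b (a :: u₁) :: u₂)) u) g w := by
      simp only [conv_cons, splitSum_add]
      congr 1
      · exact (map_splitSum (AddMonoidHom.mulLeft (f [])) _ w).symm
      · have := splitSum_assoc (fun u₁ u₂ v => f (b (a :: u₁) :: u₂) * g v) w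
        refine this.symm.trans (splitSum_congr fun u v _ => ?_)
        exact (map_splitSum (AddMonoidHom.mulRight (g v)) _ u).symm
    rw [insertSum, h1]
    simp only [conv_cons, insertSum_add, hsmul, ih, insertSum, conv_add_left, zero_mul,
      List.map_nil, List.map_cons, mul_add, zero_add]
    abel

end insertSum

end Words

/-! ### Signed shuffle sums and their compatibility with deconcatenation -/

section Shuffles

variable {α : Type*} {F : Type*} [Field F]

/-- The sign of moving the word `u` past the word `v`, if `κ y z` is that of moving `y` past `z`. -/
def crossSign (κ : α → α → F) (u v : List α) : F :=
  (v.map fun z => (u.map fun y => κ y z).prod).prod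

theorem crossSign_nil_right (κ : α → α → F) (u : List α) : crossSign κ u [] = 1 := rfl

theorem crossSign_nil_left (κ : α → α → F) (v : List α) : crossSign κ [] v = 1 := by
  simp [crossSign]

theorem crossSign_cons_right (κ : α → α → F) (u : List α) (b : α) (v : List α) :
    crossSign κ u (b :: v) = crossSign κ u [b] * crossSign κ u v := by
  simp [crossSign]

theorem crossSign_cons_left (κ : α → α → F) (a : α) (u v : List α) :
    crossSign κ (a :: u) v = crossSign κ [a] v * crossSign κ u v := by
  simp [crossSign, List.prod_map_mul]

theorem crossSign_append_left (κ : α → α → F) (u u' v : List α) :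
    crossSign κ (u ++ u') v = crossSign κ u v * crossSign κ u' v := by
  simp [crossSign, List.prod_map_mul]

variable {M : Type*} [AddCommGroup M] [Module F M]

/-- The signed sum of `f` over all shuffles of two words. -/
def shuffleSum (κ : α → α → F) (f : List α → M) : List α → List α → M
  | [], v => f v
  | a :: u, [] => f (a :: u)
  | a :: u, b :: v => shuffleSum κ (fun l => f (a :: l)) u (b :: v) +
      crossSign κ (a :: u) [b] • shuffleSum κ (fun l => f (b :: l)) (a :: u) v
  termination_by u v => u.length + v.length

theorem shuffleSum_nil_left (κ : α → α → F) (f : List α → M) (v : List α) :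
    shuffleSum κ f [] v = f v := by
  rw [shuffleSum]

theorem shuffleSum_nil_right (κ : α → α → F) (f : List α → M) (u : List α) :
    shuffleSum κ f u [] = f u := by
  cases u <;> rw [shuffleSum]

theorem shuffleSum_cons_cons (κ : α → α → F) (f : List α → M) (a b : α) (u v : List α) :
    shuffleSum κ f (a :: u) (b :: v) = shuffleSum κ (fun l => f (a :: l)) u (b :: v) +
      crossSign κ (a :: u) [b] • shuffleSum κ (fun l => f (b :: l)) (a :: u) v := by
  rw [shuffleSum]

/-- Induction along the recursion that defines `shuffleSum`. -/
theorem shuffle_induction {motive : List α → List α → Prop} (nil_left : ∀ v, motive [] v)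
    (nil_right : ∀ u, motive u [])
    (cons_cons : ∀ a u b v, motive u (b :: v) → motive (a :: u) v → motive (a :: u) (b :: v))
    (u v : List α) : motive u v := by
  induction u generalizing v with
  | nil => exact nil_left v
  | cons a u ihu =>
    induction v with
    | nil => exact nil_right _
    | cons b v ihv => exact cons_cons a u b v (ihu _) ihv

theorem shuffleSum_congr (κ : α → α → F) (u v : List α) {f g : List α → M}
    (h : ∀ l : List α, l.length = u.length + v.length → f l = g l) :
    shuffleSum κ f u v = shuffleSum κ g u v := by
  induction u, v using shuffle_induction generalizing f g with
  | nil_left v => simpa [shuffleSum_nil_left] using h v (by simp)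
  | nil_right u => simpa [shuffleSum_nil_right] using h u (by simp)
  | cons_cons a u b v hu hv =>
    rw [shuffleSum_cons_cons, shuffleSum_cons_cons]
    congr 1
    · exact hu fun l hl => h _ (by simp [hl]; omega)
    · congr 1
      exact hv fun l hl => h _ (by simp [hl]; omega)

theorem map_shuffleSum {N : Type*} [AddCommGroup N] [Module F N] (φ : M →ₗ[F] N) (κ : α → α → F)
    (f : List α → M) (u v : List α) :
    φ (shuffleSum κ f u v) = shuffleSum κ (fun l => φ (f l)) u v := by
  induction u, v using shuffle_induction generalizing f with
  | nil_left v => simp [shuffleSum_nil_left]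
  | nil_right u => simp [shuffleSum_nil_right]
  | cons_cons a u b v hu hv => simp [shuffleSum_cons_cons, hu, hv]

theorem shuffleSum_add (κ : α → α → F) (f g : List α → M) (u v : List α) :
    shuffleSum κ (fun l => f l + g l) u v = shuffleSum κ f u v + shuffleSum κ g u v := by
  induction u, v using shuffle_induction generalizing f g with
  | nil_left v => simp [shuffleSum_nil_left]
  | nil_right u => simp [shuffleSum_nil_right]
  | cons_cons a u b v hu hv => simp only [shuffleSum_cons_cons, hu, hv, smul_add]; abel

section product

variable {A : Type*} [Ring A] [Algebra F A]

theorem splitSum_smul (c : F) (K : List α → List α → A)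
    (w : List α) : splitSum (fun u v => c • K u v) w = c • splitSum K w := by
  simp [splitSum, Finset.smul_sum]

/-- Deconcatenation is compatible with shuffle products. -/
theorem shuffleSum_conv (κ : α → α → F) (f g : List α → A) (u v : List α) :
    shuffleSum κ (conv f g) u v = splitSum (fun u₁ u₂ => splitSum (fun v₁ v₂ =>
      crossSign κ u₂ v₁ • (shuffleSum κ f u₁ v₁ * shuffleSum κ g u₂ v₂)) v) u := by
  have hmul : ∀ (c : A) (k : List α → A) (u v : List α), shuffleSum κ (fun l => c * k l) u v =
      c * shuffleSum κ k u v := fun c k u v =>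
    (map_shuffleSum (LinearMap.mulLeft F c) κ k u v).symm
  induction u, v using shuffle_induction generalizing f with
  | nil_left v => simp [splitSum_nil, shuffleSum_nil_left, crossSign_nil_left, conv]
  | nil_right u => simp [splitSum_nil, shuffleSum_nil_right, crossSign_nil_right, conv]
  | cons_cons a u b v hu hv =>
    -- Moving b past the whole of a :: u is moving it past a :: u₁ inside the left factor and past
    -- u₂, which lies in the right factor.
    have hsplit : splitSum (fun u₁ u₂ => splitSum (fun v₁ v₂ => crossSign κ u₂ (b :: v₁) •
          ((crossSign κ (a :: u₁) [b] • shuffleSum κ (fun l => f (b :: l)) (a :: u₁) v₁) *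
            shuffleSum κ g u₂ v₂)) v) u =
        crossSign κ (a :: u) [b] • splitSum (fun u₁ u₂ => splitSum (fun v₁ v₂ =>
          crossSign κ u₂ v₁ • (shuffleSum κ (fun l => f (b :: l)) (a :: u₁) v₁ *
            shuffleSum κ g u₂ v₂)) v) u := by
      refine (splitSum_congr fun u₁ u₂ h => ?_).trans (splitSum_smul _ _ _)
      refine (splitSum_congr fun v₁ v₂ _ => ?_).trans (splitSum_smul _ _ _)
      rw [crossSign_cons_right, smul_mul_assoc, smul_smul, smul_smul, ← h, ← List.cons_append,
        crossSign_append_left κ (a :: u₁)]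
      congr 1
      ring
    -- The terms whose left factor takes nothing from a :: u: there b crosses all of a :: u.
    have hfirst : splitSum (fun v₁ v₂ => crossSign κ (a :: u) (b :: v₁) •
          (f (b :: v₁) * shuffleSum κ g (a :: u) v₂)) v =
        crossSign κ (a :: u) [b] • splitSum (fun v₁ v₂ => crossSign κ (a :: u) v₁ •
          (f (b :: v₁) * shuffleSum κ g (a :: u) v₂)) v := by
      refine (splitSum_congr fun v₁ v₂ _ => ?_).trans (splitSum_smul _ _ _)
      rw [crossSign_cons_right, smul_smul]
    rw [shuffleSum_cons_cons]
    simp only [conv_cons]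
    rw [shuffleSum_add, shuffleSum_add, hmul, hmul, hu, hv]
    simp only [splitSum_cons, shuffleSum_nil_left, shuffleSum_nil_right, crossSign_nil_right,
      shuffleSum_cons_cons, splitSum_add, add_mul, smul_add, mul_add, hsplit, one_smul]
    rw [hfirst]
    simp only [mul_smul_comm]
    abel

theorem splitSum_eq_last {K : List α → List α → M} {w : List α}
    (h : ∀ u v, u ++ v = w → v ≠ [] → K u v = 0) : splitSum K w = K w [] := by
  induction w generalizing K with
  | nil => exact splitSum_nil _
  | cons a w ih =>
    rw [splitSum_cons, h [] _ rfl (by simp), zero_add]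
    exact ih fun u v huv hv => h _ _ (by simp [huv]) hv

/-- If `f` and `g` vanish on shorter proper shuffles, then only the two extreme terms of the
convolution `f * g` survive on a shuffle. -/
theorem shuffleSum_conv_of_vanish (κ : α → α → F) (f g : List α → A) (u v : List α)
    (hu : u ≠ []) (hv : v ≠ []) (hf0 : f [] = 0) (hg0 : g [] = 0)
    (hf : ∀ u' v' : List α, u' ≠ [] → v' ≠ [] → (∃ u'' v'', u' ++ u'' = u ∧ v' ++ v'' = v ∧
      (u'' ≠ [] ∨ v'' ≠ [])) → shuffleSum κ f u' v' = 0)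
    (hg : ∀ u' v' : List α, u' ≠ [] → v' ≠ [] → (∃ u'' v'', u'' ++ u' = u ∧ v'' ++ v' = v ∧
      (u'' ≠ [] ∨ v'' ≠ [])) → shuffleSum κ g u' v' = 0) :
    shuffleSum κ (conv f g) u v = f u * g v + crossSign κ u v • (f v * g u) := by
  obtain ⟨a, u, rfl⟩ := List.exists_cons_of_ne_nil hu
  rw [shuffleSum_conv, splitSum_cons, add_comm]
  congr 1
  -- Left factors that contain a: only u₁ = a :: u together with v₁ = [] survives. Otherwise one of
  -- the two factors is a proper shuffle or the right word is empty.
  · rw [splitSum_eq_last]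
    · obtain ⟨b, v, rfl⟩ := List.exists_cons_of_ne_nil hv
      rw [splitSum_cons, splitSum_eq_zero]
      · simp [shuffleSum_nil_right, shuffleSum_nil_left, crossSign_nil_right]
      · intro v₁ v₂ h
        by_cases h2 : v₂ = []
        · simp [h2, shuffleSum_nil_left, hg0]
        · rw [hf _ _ (by simp) (by simp) ⟨[], v₂, by simp, by simp [h], Or.inr h2⟩]
          simp
    · intro u₁ u₂ h h2
      refine splitSum_eq_zero fun v₁ v₂ h' => ?_
      by_cases h1 : v₁ = []
      · subst h1
        rw [List.nil_append] at h'
        subst h'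
        rw [hg _ _ h2 hv ⟨a :: u₁, [], by simp [h], by simp, by simp⟩]
        simp
      · rw [hf _ _ (by simp) h1 ⟨u₂, v₂, by simp [h], h', Or.inl h2⟩]
        simp
  -- Left factors that take nothing from a :: u: only the one consisting of all of v survives.
  · rw [splitSum_eq_last]
    · simp [shuffleSum_nil_right, shuffleSum_nil_left]
    · intro v₁ v₂ h h2
      by_cases h1 : v₁ = []
      · simp [h1, shuffleSum_nil_left, hf0]
      · rw [hg _ _ (by simp) h2 ⟨[], v₁, by simp, h, Or.inr h1⟩]
        simp

end product

end Shuffles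

/-! ### Shuffle permutations and the recursive shuffle sum -/

section PermShuffles

/-- The permutation of `Fin (n + 1)` that sends `j` to `0` and is given by `τ` on the other
elements. -/
def permInsert {n : ℕ} (j : Fin (n + 1)) (τ : Equiv.Perm (Fin n)) : Equiv.Perm (Fin (n + 1)) :=
  ((finSuccEquiv' j).trans τ.optionCongr).trans (finSuccEquiv' 0).symm

theorem permInsert_self {n : ℕ} (j : Fin (n + 1)) (τ : Equiv.Perm (Fin n)) :
    permInsert j τ j = 0 := by
  simp [permInsert]

theorem permInsert_succAbove {n : ℕ} (j : Fin (n + 1)) (τ : Equiv.Perm (Fin n)) (i : Fin n) :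
    permInsert j τ (j.succAbove i) = (τ i).succ := by
  simp [permInsert]

theorem permInsert_symm_zero {n : ℕ} (j : Fin (n + 1)) (τ : Equiv.Perm (Fin n)) :
    (permInsert j τ).symm 0 = j := by
  rw [Equiv.symm_apply_eq, permInsert_self]

theorem permInsert_symm_succ {n : ℕ} (j : Fin (n + 1)) (τ : Equiv.Perm (Fin n)) (i : Fin n) :
    (permInsert j τ).symm i.succ = j.succAbove (τ.symm i) := by
  rw [Equiv.symm_apply_eq, permInsert_succAbove, Equiv.apply_symm_apply]

theorem permInsert_bijective (n : ℕ) :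
    Function.Bijective fun q : Fin (n + 1) × Equiv.Perm (Fin n) => permInsert q.1 q.2 := by
  rw [Fintype.bijective_iff_injective_and_card]
  constructor
  · rintro ⟨j, τ⟩ ⟨j', τ'⟩ h
    have h : permInsert j τ = permInsert j' τ' := h
    obtain rfl : j = j' := by rw [← permInsert_symm_zero j τ, h, permInsert_symm_zero]
    congr 1
    ext i
    have := congrArg (fun σ => σ (j.succAbove i)) h
    simp only [permInsert_succAbove, Fin.succ_inj] at this
    rw [this]
  · simp [Fintype.card_perm, Nat.factorial_succ]

/-- `σ` is increasing on `{0, …, c - 1}` and on its complement. -/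
def IsCutShuffle (c : ℕ) {n : ℕ} (σ : Equiv.Perm (Fin n)) : Prop :=
  ∀ i j : Fin n, i < j → ((j : ℕ) < c ∨ c ≤ (i : ℕ)) → σ i < σ j

theorem isShuffle_iff_isCutShuffle (a b : ℕ) (σ : Equiv.Perm (Fin (a + b))) :
    IsShuffle a b σ ↔ IsCutShuffle a σ := by
  constructor
  · rintro ⟨h1, h2⟩ i j hij h
    rcases h with h | h
    · exact @h1 ⟨i, by omega⟩ ⟨j, h⟩ hij
    · have := @h2 ⟨i - a, by omega⟩ ⟨j - a, by omega⟩ (by simp only [Fin.mk_lt_mk]; omega)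
      have e1 : Fin.natAdd a ⟨i - a, by omega⟩ = i := by ext; simp; omega
      have e2 : Fin.natAdd a ⟨j - a, by omega⟩ = j := by ext; simp; omega
      simpa only [e1, e2] using this
  · intro h
    refine ⟨fun i j hij => h _ _ hij (Or.inl (by simp)),
      fun i j hij => h _ _ (by simpa using hij) (Or.inr (by simp))⟩

/-- The truncated `c - 1` is harmless: at c = 0 both sides say that the permutation is increasing.
-/
theorem isCutShuffle_permInsert_zero (c : ℕ) {n : ℕ} (τ : Equiv.Perm (Fin n)) :
    IsCutShuffle c (permInsert 0 τ) ↔ IsCutShuffle (c - 1) τ := by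
  have e : ∀ i : Fin n, permInsert 0 τ i.succ = (τ i).succ := fun i => by
    simpa using permInsert_succAbove 0 τ i
  constructor
  · intro h i j hij hc
    have := h i.succ j.succ (by simpa using hij) (by simp only [Fin.val_succ]; omega)
    simpa [e] using this
  · intro h i j hij hc
    induction j using Fin.cases with
    | zero => simp at hij
    | succ j =>
      induction i using Fin.cases with
      | zero => rw [permInsert_self, e]; exact Fin.succ_pos _
      | succ i =>
        rw [e, e, Fin.succ_lt_succ_iff]
        exact h i j (by simpa using hij) (by simp only [Fin.val_succ] at hc; omega)

/-- Removing the first element of the second block does not move the first block, so the cut stays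
at c. -/
theorem isCutShuffle_permInsert_cut {n : ℕ} (c : Fin (n + 1)) (τ : Equiv.Perm (Fin n)) :
    IsCutShuffle c (permInsert c τ) ↔ IsCutShuffle c τ := by
  have hlt : ∀ i : Fin n, (c.succAbove i : ℕ) < c ↔ (i : ℕ) < c := by
    intro i
    simp only [Fin.succAbove, Fin.lt_def, Fin.val_castSucc]
    split_ifs with h
    · simp [h]
    · simp; omega
  constructor
  · intro h i j hij hc
    have := h (c.succAbove i) (c.succAbove j) (by simpa using hij) (by
      have := hlt i; have := hlt j; omega)
    simpa [permInsert_succAbove] using this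
  · intro h i j hij hc
    induction j using c.succAboveCases with
    | x =>
      exfalso
      rw [Fin.lt_def] at hij
      omega
    | p j =>
      induction i using c.succAboveCases with
      | x => rw [permInsert_self, permInsert_succAbove]; exact Fin.succ_pos _
      | p i =>
        rw [permInsert_succAbove, permInsert_succAbove, Fin.succ_lt_succ_iff]
        exact h i j (by simpa using hij) (by have := hlt i; have := hlt j; omega)

/-- Unless j starts a block, j - 1 lies in the same block and would have to be sent below 0. -/
theorem not_isCutShuffle_permInsert {c n : ℕ} {j : Fin (n + 1)} (h0 : j ≠ 0) (hc : (j : ℕ) ≠ c)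
    (τ : Equiv.Perm (Fin n)) : ¬ IsCutShuffle c (permInsert j τ) := by
  intro h
  have h0' : (j : ℕ) ≠ 0 := fun e => h0 (Fin.ext e)
  have := h ⟨j - 1, by omega⟩ j (by simp only [Fin.lt_def]; omega) (by dsimp only; omega)
  rw [permInsert_self] at this
  simp at this

variable {α : Type*} {F : Type*} [Field F]

/-- The product of `κ (x i) (x j)` over all inversions `(i, j)` of `σ`. -/
def inversionProd (κ : α → α → F) {n : ℕ} (x : Fin n → α) (σ : Equiv.Perm (Fin n)) : F :=
  ∏ ij ∈ Finset.univ.filter (fun ij : Fin n × Fin n => ij.1 < ij.2 ∧ σ ij.2 < σ ij.1),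
    κ (x ij.1) (x ij.2)

/-- Since j is sent to 0, it forms an inversion with exactly the elements before it; all other
inversions are those of τ. -/
theorem inversionProd_permInsert (κ : α → α → F) {n : ℕ} (x : Fin (n + 1) → α) (j : Fin (n + 1))
    (τ : Equiv.Perm (Fin n)) :
    inversionProd κ x (permInsert j τ) =
      (∏ i : Fin n, if (i : ℕ) < j then κ (x (j.succAbove i)) (x j) else 1) *
        inversionProd κ (fun i => x (j.succAbove i)) τ := by
  simp only [inversionProd, Finset.prod_filter, Fintype.prod_prod_type]
  rw [Fin.prod_univ_succAbove _ j]
  simp only [Fin.prod_univ_succAbove _ j, permInsert_self, permInsert_succAbove, Fin.not_lt_zero,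
    and_false, if_false, Finset.prod_const_one, one_mul, Fin.succ_pos, and_true,
    Fin.succ_lt_succ_iff, Fin.succAbove_lt_succAbove_iff, Finset.prod_mul_distrib]
  congr 1
  refine Finset.prod_congr rfl fun i _ => ?_
  have h : j.succAbove i < j ↔ (i : ℕ) < j := by
    rw [Fin.succAbove_lt_iff_castSucc_lt, Fin.lt_def, Fin.val_castSucc]
  simp only [h]

theorem prod_take_ofFn (c : ℕ) {n : ℕ} (g : Fin n → F) :
    ((List.ofFn g).take c).prod = ∏ i : Fin n, if (i : ℕ) < c then g i else 1 := by
  induction n generalizing c with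
  | zero => simp
  | succ n ih =>
    rw [List.ofFn_succ, Fin.prod_univ_succ]
    cases c with
    | zero => simp
    | succ c => simp [ih]

theorem take_ofFn_succAbove {n : ℕ} (x : Fin (n + 1) → α) (c : Fin (n + 1)) :
    (List.ofFn fun i => x (c.succAbove i)).take c = (List.ofFn x).take c := by
  have := c.2
  apply List.ext_getElem
  · simp; omega
  · intro i h1 h2
    simp only [List.length_take, List.length_ofFn] at h1
    simp only [List.getElem_take, List.getElem_ofFn]
    rw [Fin.succAbove_of_castSucc_lt _ _ (by simp only [Fin.lt_def, Fin.val_castSucc]; omega)]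
    rfl

theorem drop_ofFn_succAbove {n : ℕ} (x : Fin (n + 1) → α) (c : Fin (n + 1)) :
    (List.ofFn x).drop c = x c :: (List.ofFn fun i => x (c.succAbove i)).drop c := by
  have := c.2
  apply List.ext_getElem
  · simp; omega
  · intro i h1 h2
    cases i with
    | zero => simp [-List.ofFn_succ]
    | succ i =>
      simp only [List.length_drop, List.length_ofFn] at h1
      simp only [List.getElem_drop, List.getElem_ofFn, List.getElem_cons_succ]
      rw [Fin.succAbove_of_le_castSucc _ _ (by simp only [Fin.le_def, Fin.val_castSucc]; omega)]
      rfl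

variable {M : Type*} [AddCommGroup M] [Module F M]

-- The letter that a shuffle puts first is the first letter of one of the two blocks. Sorting
-- permutations by the preimage of 0 therefore reproduces the two branches of the recursion for
-- `shuffleSum`, and the inversions of that letter give the `crossSign`.
open Classical in
theorem sum_isCutShuffle (κ : α → α → F) {n : ℕ} (c : ℕ) (hc : c ≤ n) (x : Fin n → α)
    (f : List α → M) :
    ∑ σ ∈ Finset.univ.filter (fun σ : Equiv.Perm (Fin n) => IsCutShuffle c σ),
      inversionProd κ x σ • f (List.ofFn fun i => x (σ.symm i)) =
    shuffleSum κ f ((List.ofFn x).take c) ((List.ofFn x).drop c) := by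
  induction n generalizing c f with
  | zero =>
    rw [Finset.filter_true_of_mem (fun σ _ i => i.elim0)]
    simp [shuffleSum_nil_left, inversionProd]
  | succ n ih =>
    have hsum : ∀ j : Fin (n + 1),
        (∑ τ : Equiv.Perm (Fin n), if IsCutShuffle c (permInsert j τ) then
          inversionProd κ x (permInsert j τ) •
            f (List.ofFn fun i => x ((permInsert j τ).symm i)) else 0) =
        ∑ τ : Equiv.Perm (Fin n), if IsCutShuffle c (permInsert j τ) then
          (∏ i : Fin n, if (i : ℕ) < j then κ (x (j.succAbove i)) (x j) else 1) •
            inversionProd κ (fun i => x (j.succAbove i)) τ •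
              f (x j :: List.ofFn fun i => x (j.succAbove (τ.symm i))) else 0 := by
      intro j
      refine Finset.sum_congr rfl fun τ _ => ?_
      rw [inversionProd_permInsert, mul_smul, List.ofFn_succ]
      simp only [permInsert_symm_zero, permInsert_symm_succ]
    have h0 : (∑ τ : Equiv.Perm (Fin n), if IsCutShuffle c (permInsert 0 τ) then
          inversionProd κ x (permInsert 0 τ) •
            f (List.ofFn fun i => x ((permInsert 0 τ).symm i)) else 0) =
        shuffleSum κ (fun l => f (x 0 :: l)) ((List.ofFn fun i : Fin n => x i.succ).take (c - 1))
          ((List.ofFn fun i : Fin n => x i.succ).drop (c - 1)) := by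
      rw [hsum, ← ih (c - 1) (by omega), Finset.sum_filter]
      refine Finset.sum_congr rfl fun τ _ => ?_
      simp [isCutShuffle_permInsert_zero]
    rw [Finset.sum_filter, ← (permInsert_bijective n).sum_comp, Fintype.sum_prod_type]
    have hz : ∀ j : Fin (n + 1), j ≠ 0 → (j : ℕ) ≠ c →
        (∑ τ : Equiv.Perm (Fin n), if IsCutShuffle c (permInsert j τ) then
          inversionProd κ x (permInsert j τ) •
            f (List.ofFn fun i => x ((permInsert j τ).symm i)) else 0) = 0 := fun j h1 h2 =>
      Finset.sum_eq_zero fun τ _ => if_neg (not_isCutShuffle_permInsert h1 h2 τ)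
    -- Both blocks are nonempty exactly in this case. Otherwise there is a single block, and only
    -- the preimage 0 contributes.
    by_cases hc' : 0 < c ∧ c < n + 1
    · obtain ⟨c, rfl⟩ : ∃ c' : Fin (n + 1), (c' : ℕ) = c := ⟨⟨c, hc'.2⟩, rfl⟩
      have hne : (0 : Fin (n + 1)) ≠ c := by
        intro h
        have := congrArg Fin.val h
        rw [Fin.val_zero] at this
        omega
      rw [Finset.sum_eq_add_of_mem 0 c (Finset.mem_univ _) (Finset.mem_univ _) hne
        (fun j _ hj => hz j hj.1 fun h => hj.2 (Fin.ext h)), h0, hsum]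
      simp only [isCutShuffle_permInsert_cut]
      rw [← Finset.sum_filter, ← Finset.smul_sum,
        ih c (by omega) (fun i => x (c.succAbove i)) (fun l => f (x c :: l)),
        take_ofFn_succAbove, drop_ofFn_succAbove]
      obtain ⟨c', hc1⟩ : ∃ c' : ℕ, (c : ℕ) = c' + 1 := ⟨c - 1, by omega⟩
      have ht : (List.ofFn x).take c = x 0 :: (List.ofFn fun i : Fin n => x i.succ).take c' := by
        rw [List.ofFn_succ, hc1, List.take_succ_cons]
      have hd : (List.ofFn x).drop c = (List.ofFn fun i : Fin n => x i.succ).drop c' := by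
        rw [List.ofFn_succ, hc1, List.drop_succ_cons]
      have hcross : (∏ i : Fin n, if (i : ℕ) < c then κ (x (c.succAbove i)) (x c) else 1) =
          crossSign κ ((List.ofFn x).take c) [x c] := by
        rw [← prod_take_ofFn, ← take_ofFn_succAbove]
        simp [crossSign, List.map_take, List.map_ofFn, Function.comp_def]
      rw [hcross, ht, shuffleSum_cons_cons, ← drop_ofFn_succAbove, hd, hc1, Nat.add_sub_cancel]
    · rw [Finset.sum_eq_single 0 (fun j _ hj => hz j hj fun h => hc' ⟨by
          have : (j : ℕ) ≠ 0 := fun e => hj (Fin.ext e)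
          omega, by omega⟩) (by simp), h0]
      rcases Nat.eq_zero_or_pos c with rfl | hpos
      · simp [shuffleSum_nil_left, List.ofFn_succ]
      · obtain rfl : c = n + 1 := by omega
        rw [List.drop_of_length_le (by simp), List.drop_of_length_le (by simp),
          List.take_of_length_le (by simp), List.take_of_length_le (by simp),
          shuffleSum_nil_right, shuffleSum_nil_right, List.ofFn_succ]

end PermShuffles

/-- The sign comparisons below end here; the witness given for evenness is half the difference of
the two exponents. -/
theorem neg_one_zpow_eq_of_even_sub {F : Type*} [Field F] {a b : ℤ} (h : Even (a - b)) :
    (-1 : F) ^ a = (-1 : F) ^ b := by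
  obtain ⟨c, hc⟩ := h
  have : a = b + 2 * c := by omega
  rw [this, zpow_add₀ (by simp), zpow_mul]
  simp

/-! ### The sign twist, the Hodge projection and the sign-free transfer -/

section DGCA

variable {F : Type*} [Field F] {A : Type*} [Ring A] [Algebra F A]
  (𝒜 : ℤ → Submodule F A) [GradedAlgebra 𝒜]

theorem signTwist_one_apply {k : ℤ} {x : A} (hx : x ∈ 𝒜 k) :
    signTwist 𝒜 1 x = (-1 : F) ^ k • x := by
  rw [signTwist_apply 𝒜 1 k x hx, one_mul]

theorem signTwist_mem {k : ℤ} {x : A} (hx : x ∈ 𝒜 k) : signTwist 𝒜 1 x ∈ 𝒜 k := by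
  rw [signTwist_one_apply 𝒜 hx]
  exact (𝒜 k).smul_mem _ hx

theorem signTwist_signTwist (x : A) : signTwist 𝒜 1 (signTwist 𝒜 1 x) = x := by
  induction x using DirectSum.Decomposition.inductionOn 𝒜 with
  | zero => simp
  | @homogeneous i m =>
    rw [signTwist_one_apply 𝒜 m.2, map_smul, signTwist_one_apply 𝒜 m.2, smul_smul, ← mul_zpow]
    simp
  | add a b ha hb => rw [map_add, map_add, ha, hb]

theorem signTwist_mul (x y : A) :
    signTwist 𝒜 1 (x * y) = signTwist 𝒜 1 x * signTwist 𝒜 1 y := by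
  induction x using DirectSum.Decomposition.inductionOn 𝒜 with
  | zero => simp
  | @homogeneous i m =>
    induction y using DirectSum.Decomposition.inductionOn 𝒜 with
    | zero => simp
    | @homogeneous j m' =>
      rw [signTwist_one_apply 𝒜 m.2, signTwist_one_apply 𝒜 m'.2,
        signTwist_one_apply 𝒜 (SetLike.mul_mem_graded m.2 m'.2), zpow_add₀ (by simp),
        smul_mul_smul_comm]
    | add a b ha hb => rw [mul_add, map_add, map_add, ha, hb, mul_add]
  | add a b ha hb => rw [add_mul, map_add, map_add, ha, hb, add_mul]

variable {𝒜}

theorem DGCA.d_mul (C : DGCA 𝒜) (x y : A) :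
    C.d (x * y) = C.d x * y + signTwist 𝒜 1 x * C.d y := by
  have h := C.d_signTwist_mul (signTwist 𝒜 1 x) y
  rwa [signTwist_signTwist] at h

namespace HodgeHomotopy

variable {n : ℕ} {P : PDGCA 𝒜 n} (δ : HodgeHomotopy P)

theorem dm_signTwist (x : A) : δ.dm (signTwist 𝒜 1 x) = - signTwist 𝒜 1 (δ.dm x) := by
  induction x using DirectSum.Decomposition.inductionOn 𝒜 with
  | zero => simp
  | @homogeneous i m =>
    rw [signTwist_one_apply 𝒜 m.2, signTwist_one_apply 𝒜 (δ.dm_mem _ _ m.2), map_smul,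
      zpow_sub_one₀ (by simp)]
    simp
  | add a b ha hb => simp only [map_add, ha, hb]; abel

theorem proj_apply (x : A) : δ.proj x = x - (P.d (δ.dm x) + δ.dm (P.d x)) := rfl

theorem proj_d (x : A) : δ.proj (P.d x) = 0 := by
  rw [proj_apply, P.d_d, map_zero, add_zero, δ.d_dm_d, sub_self]

theorem proj_dm (x : A) : δ.proj (δ.dm x) = 0 := by
  rw [proj_apply, δ.dm_dm, map_zero, zero_add, δ.dm_d_dm, sub_self]

theorem d_proj (x : A) : P.d (δ.proj x) = 0 := by
  rw [proj_apply, map_sub, map_add, P.d_d, zero_add, δ.d_dm_d, sub_self]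

theorem dm_proj (x : A) : δ.dm (δ.proj x) = 0 := by
  rw [proj_apply, map_sub, map_add, δ.dm_dm, add_zero, δ.dm_d_dm, sub_self]

theorem proj_mem {k : ℤ} {x : A} (hx : x ∈ 𝒜 k) : δ.proj x ∈ 𝒜 k := by
  have h1 := P.d_mem _ _ (δ.dm_mem _ _ hx)
  have h2 := δ.dm_mem _ _ (P.d_mem _ _ hx)
  rw [sub_add_cancel] at h1
  rw [add_sub_cancel_right] at h2
  exact (𝒜 k).sub_mem hx ((𝒜 k).add_mem h1 h2)

theorem d_harmonic (x : δ.harmonic) : P.d (x : A) = 0 := by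
  obtain ⟨y, hy⟩ := x.2
  rw [← hy, δ.d_proj]

theorem dm_harmonic (x : δ.harmonic) : δ.dm (x : A) = 0 := by
  obtain ⟨y, hy⟩ := x.2
  rw [← hy, δ.dm_proj]

theorem proj_harmonic (x : δ.harmonic) : δ.proj (x : A) = x := by
  rw [proj_apply, d_harmonic, dm_harmonic]
  simp

/-- The homotopy transfer without signs: `G(x) = x` on one-letter words and
`G(w) = d⁻ ∑_{w = u v} τ(G(u)) G(v)` on longer words, where `τ x = (-1)^{|x|} x`. -/
def treeWord : List A → A
  | [] => 0
  | [x] => x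
  | x :: y :: w => δ.dm (∑ i : Fin (w.length + 1),
      signTwist 𝒜 1 (treeWord ((x :: y :: w).take (i + 1))) *
        treeWord ((x :: y :: w).drop (i + 1)))
  termination_by w => w.length
  decreasing_by
    · simp; omega
    · simp

/-- The sum `∑_{w = u v} τ(G(u)) G(v)`; up to sign this is `m̂_k` on words of length `k`. -/
def hatWord : List A → A :=
  conv (fun u => signTwist 𝒜 1 (δ.treeWord u)) δ.treeWord

@[simp]
theorem treeWord_nil : δ.treeWord [] = 0 := by rw [treeWord]

@[simp]
theorem treeWord_singleton (x : A) : δ.treeWord [x] = x := by rw [treeWord]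

@[simp]
theorem hatWord_nil : δ.hatWord [] = 0 := by simp [hatWord, conv_nil]

@[simp]
theorem hatWord_singleton (x : A) : δ.hatWord [x] = 0 := by simp [hatWord, conv_nil, conv_cons]

theorem treeWord_of_two_le {w : List A} (hw : 2 ≤ w.length) :
    δ.treeWord w = δ.dm (δ.hatWord w) := by
  match w, hw with
  | x :: y :: w, _ =>
    -- `treeWord` sums over factorizations into nonempty words, `hatWord` over all of them; the two
    -- extra ends vanish because `treeWord []` is 0.
    rw [treeWord, hatWord, conv, splitSum, Finset.sum_range_succ, List.length_cons,
      List.length_cons, Finset.sum_range_succ',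
      ← Fin.sum_univ_eq_sum_range (fun i => signTwist 𝒜 1 (δ.treeWord ((x :: y :: w).take (i + 1))) *
        δ.treeWord ((x :: y :: w).drop (i + 1)))]
    simp

/-- The letter of a one-letter word; zero on all other words. -/
def letter {R : Type*} [Zero R] : List R → R
  | [x] => x
  | _ => 0

theorem treeWord_eq (w : List A) : δ.treeWord w = letter w + δ.dm (δ.hatWord w) := by
  match w with
  | [] => simp [letter]
  | [x] => simp [letter]
  | x :: y :: w => rw [treeWord_of_two_le _ (by simp), letter, zero_add]; simp

theorem word_induction {α : Type*} {motive : List α → Prop} (nil : motive [])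
    (singleton : ∀ a, motive [a])
    (step : ∀ w, 2 ≤ w.length → (∀ u, u.length < w.length → motive u) → motive w)
    (w : List α) : motive w := by
  induction hl : w.length using Nat.strong_induction_on generalizing w with
  | _ l ih =>
    match w, hl with
    | [], _ => exact nil
    | [a], _ => exact singleton a
    | a :: b :: w, hl => exact step _ (by simp) fun u hu => ih _ (by omega) u rfl

/-- Two-fold factorizations into nonempty words suffice to compute `hatWord`. -/
theorem hatWord_map_congr {α : Type*} (φ : α → A) {w : List α} {K : List α → List α → A}
    (h : ∀ u v, u ++ v = w → u ≠ [] → v ≠ [] →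
      signTwist 𝒜 1 (δ.treeWord (u.map φ)) * δ.treeWord (v.map φ) = K u v)
    (h1 : K [] w = 0) (h2 : K w [] = 0) : δ.hatWord (w.map φ) = splitSum K w := by
  rw [hatWord, conv_map]
  refine splitSum_congr fun u v huv => ?_
  by_cases hu : u = []
  · subst hu
    rw [List.nil_append] at huv
    simp [huv, h1]
  · by_cases hv : v = []
    · subst hv
      rw [List.append_nil] at huv
      simp [huv, h2]
    · exact h u v huv hu hv

theorem length_lt_of_append {α : Type*} {u v w : List α} (h : u ++ v = w) (hu : u ≠ [])
    (hv : v ≠ []) : u.length < w.length ∧ v.length < w.length := by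
  have := List.length_pos_of_ne_nil hu
  have := List.length_pos_of_ne_nil hv
  rw [← h, List.length_append]
  omega

/-- Multilinearity for a function of lists, with each letter carrying its own scalar. Assuming it
for `treeWord` only on shorter words makes the lemma usable inside the induction that proves it for
`treeWord`. -/
theorem hatWord_smul_of_treeWord {w : List (F × A)} (h : ∀ u : List (F × A), u.length < w.length →
      δ.treeWord (u.map fun q => q.1 • q.2) =
        (u.map Prod.fst).prod • δ.treeWord (u.map Prod.snd)) :
    δ.hatWord (w.map fun q => q.1 • q.2) =
      (w.map Prod.fst).prod • δ.hatWord (w.map Prod.snd) := by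
  have e : (w.map Prod.fst).prod • δ.hatWord (w.map Prod.snd) = splitSum (fun u v =>
      (w.map Prod.fst).prod • (signTwist 𝒜 1 (δ.treeWord (u.map Prod.snd)) *
        δ.treeWord (v.map Prod.snd))) w := by
    rw [splitSum_smul, hatWord, conv_map]
    rfl
  rw [e]
  refine δ.hatWord_map_congr _ (fun u v huv hu hv => ?_) (by simp) (by simp)
  obtain ⟨h1, h2⟩ := length_lt_of_append huv hu hv
  rw [h u h1, h v h2, map_smul, smul_mul_smul_comm, ← huv, List.map_append, List.prod_append]

theorem treeWord_smul (w : List (F × A)) : δ.treeWord (w.map fun q => q.1 • q.2) =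
    (w.map Prod.fst).prod • δ.treeWord (w.map Prod.snd) := by
  induction w using word_induction with
  | nil => simp
  | singleton a => simp
  | step w hw ih =>
    rw [treeWord_of_two_le _ (by simpa using hw), treeWord_of_two_le _ (by simpa using hw),
      δ.hatWord_smul_of_treeWord ih, map_smul]

theorem hatWord_smul (w : List (F × A)) : δ.hatWord (w.map fun q => q.1 • q.2) =
    (w.map Prod.fst).prod • δ.hatWord (w.map Prod.snd) :=
  δ.hatWord_smul_of_treeWord fun u _ => δ.treeWord_smul u

/-- The map -τ is the sign of the shifted degree |x| - 1, and `treeWord` preserves total shifted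
degree. In the proof, each d⁻ anticommutes with τ, while τ is multiplicative. -/
theorem treeWord_neg_signTwist (w : List A) :
    δ.treeWord (w.map fun x => - signTwist 𝒜 1 x) = - signTwist 𝒜 1 (δ.treeWord w) := by
  induction w using word_induction with
  | nil => simp
  | singleton a => simp
  | step w hw ih =>
    have e : signTwist 𝒜 1 (δ.hatWord w) = splitSum (fun u v => signTwist 𝒜 1
        (signTwist 𝒜 1 (δ.treeWord u) * δ.treeWord v)) w := by
      rw [hatWord, conv, map_splitSum]
    rw [treeWord_of_two_le _ (by simpa using hw), treeWord_of_two_le _ hw, ← dm_signTwist, e]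
    congr 1
    refine δ.hatWord_map_congr _ (fun u v huv hu hv => ?_) (by simp) (by simp)
    obtain ⟨h1, h2⟩ := length_lt_of_append huv hu hv
    rw [ih u h1, ih v h2, signTwist_mul, map_neg, neg_mul_neg]

/-- The total degree of a word of elements with given degrees. -/
def wordDegree {R : Type*} (w : List (ℤ × R)) : ℤ := (w.map Prod.fst).sum

/-- A word of homogeneous elements, together with their degrees. -/
def IsHomogeneousWord (𝒜 : ℤ → Submodule F A) (w : List (ℤ × A)) : Prop :=
  ∀ q ∈ w, q.2 ∈ 𝒜 q.1

theorem hatWord_mem_of_treeWord {w : List (ℤ × A)} (h : ∀ u v, u ++ v = w → u ≠ [] → v ≠ [] →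
    δ.treeWord (u.map Prod.snd) ∈ 𝒜 (wordDegree u + 1 - u.length) ∧
    δ.treeWord (v.map Prod.snd) ∈ 𝒜 (wordDegree v + 1 - v.length)) :
    δ.hatWord (w.map Prod.snd) ∈ 𝒜 (wordDegree w + 2 - w.length) := by
  rw [hatWord, conv_map, conv, splitSum]
  refine Submodule.sum_mem _ fun i _ => ?_
  by_cases hu : w.take i = []
  · simp [hu]
  by_cases hv : w.drop i = []
  · simp [hv]
  have huv := List.take_append_drop i w
  obtain ⟨h1, h2⟩ := h _ _ huv hu hv
  have h3 := SetLike.mul_mem_graded (signTwist_mem 𝒜 h1) h2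
  convert h3 using 2
  conv_lhs => rw [← huv]
  simp only [wordDegree, List.map_append, List.sum_append, List.length_append]
  push_cast
  ring

theorem treeWord_mem {w : List (ℤ × A)} (hw : IsHomogeneousWord 𝒜 w) :
    δ.treeWord (w.map Prod.snd) ∈ 𝒜 (wordDegree w + 1 - w.length) := by
  induction w using word_induction with
  | nil => simp
  | singleton a => simpa [wordDegree] using hw a (by simp)
  | step w hw2 ih =>
    rw [treeWord_of_two_le _ (by simpa using hw2)]
    have h := δ.dm_mem _ _ (δ.hatWord_mem_of_treeWord (w := w) fun u v huv hu hv => by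
      obtain ⟨h1, h2⟩ := length_lt_of_append huv hu hv
      exact ⟨ih u h1 fun q hq => hw q (by simp [← huv, hq]),
        ih v h2 fun q hq => hw q (by simp [← huv, hq])⟩)
    convert h using 2
    ring

theorem hatWord_mem {w : List (ℤ × A)} (hw : IsHomogeneousWord 𝒜 w) :
    δ.hatWord (w.map Prod.snd) ∈ 𝒜 (wordDegree w + 2 - w.length) :=
  δ.hatWord_mem_of_treeWord fun _ _ huv _ _ =>
    ⟨δ.treeWord_mem fun q hq => hw q (by simp [← huv, hq]),
      δ.treeWord_mem fun q hq => hw q (by simp [← huv, hq])⟩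

end HodgeHomotopy

end DGCA

theorem insertSum_eq_zero {α M : Type*} [AddCommMonoid M] (b : List α → α) (θ : α → α)
    {f : List α → M} (hf : ∀ a l, f (a :: l) = 0) (w : List α) : insertSum b θ f w = 0 := by
  induction w generalizing f with
  | nil => rfl
  | cons a w ih => simp [insertSum, hf, ih, splitSum]

theorem crossSign_zpow {α F : Type*} [Field F] (f g : α → ℤ) (u v : List α) :
    crossSign (fun q r => (-1 : F) ^ (f q * g r)) u v =
      (-1 : F) ^ ((u.map f).sum * (v.map g).sum) := by
  have h1 : ∀ (c : ℤ) (u : List α), (u.map fun y => (-1 : F) ^ (f y * c)).prod =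
      (-1 : F) ^ ((u.map f).sum * c) := by
    intro c u
    induction u with
    | nil => simp
    | cons a u ih => simp [ih, add_mul, zpow_add₀]
  simp only [crossSign, h1]
  induction v with
  | nil => simp
  | cons b v ih => simp [ih, mul_add, zpow_add₀]

/-! ### Integration, Stokes and adjointness -/

section DGCA

variable {F : Type*} [Field F] {A : Type*} [Ring A] [Algebra F A]
  {𝒜 : ℤ → Submodule F A} [GradedAlgebra 𝒜] {n : ℕ}

namespace PDGCA

variable (P : PDGCA 𝒜 n)

/-- The integral `A → F`, the projection to `A^n` followed by the fundamental class. -/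
def integral : A →ₗ[F] F := P.fund ∘ₗ P.coboundaries.mkQ ∘ₗ P.topCocycle

theorem pairing_apply (x y : A) : P.pairing x y = P.integral (x * y) := rfl

theorem coe_topCocycle (x : A) :
    (P.topCocycle x : A) = (DirectSum.decompose 𝒜 x (n : ℤ) : A) := rfl

theorem decompose_d (x : A) (k : ℤ) :
    (DirectSum.decompose 𝒜 (P.d x) (k + 1) : A) = P.d (DirectSum.decompose 𝒜 x k : A) := by
  induction x using DirectSum.Decomposition.inductionOn 𝒜 with
  | zero => simp
  | @homogeneous i m =>
    by_cases h : i = k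
    · subst h
      rw [DirectSum.decompose_of_mem_same 𝒜 m.2, DirectSum.decompose_of_mem_same 𝒜 (P.d_mem _ _ m.2)]
    · rw [DirectSum.decompose_of_mem_ne 𝒜 m.2 h,
        DirectSum.decompose_of_mem_ne 𝒜 (P.d_mem _ _ m.2) (by omega), map_zero]
  | add a b ha hb =>
    simp only [map_add, DirectSum.decompose_add, DirectSum.add_apply, Submodule.coe_add, ha, hb]

/-- Stokes: the degree n component of dx is d of the degree n - 1 component of x, hence a
coboundary. -/
theorem integral_d (x : A) : P.integral (P.d x) = 0 := by
  have h : P.coboundaries.mkQ (P.topCocycle (P.d x)) = 0 := by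
    rw [Submodule.mkQ_apply, Submodule.Quotient.mk_eq_zero]
    refine ⟨(DirectSum.decompose 𝒜 x ((n : ℤ) - 1) : A), ?_⟩
    have := P.decompose_d x ((n : ℤ) - 1)
    rw [sub_add_cancel] at this
    exact this.symm
  simp [integral, h]

theorem integral_of_mem {k : ℤ} (hk : k ≠ n) {x : A} (hx : x ∈ 𝒜 k) : P.integral x = 0 := by
  have h : P.topCocycle x = 0 :=
    Subtype.ext (by rw [coe_topCocycle, DirectSum.decompose_of_mem_ne 𝒜 hx hk]; rfl)
  simp [integral, h]

theorem pairing_of_mem {p q : ℤ} (h : p + q ≠ n) {x y : A} (hx : x ∈ 𝒜 p) (hy : y ∈ 𝒜 q) :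
    P.pairing x y = 0 :=
  P.integral_of_mem h (SetLike.mul_mem_graded hx hy)

theorem pairing_symm {p q : ℤ} {x y : A} (hx : x ∈ 𝒜 p) (hy : y ∈ 𝒜 q) :
    P.pairing x y = (-1 : F) ^ (p * q) * P.pairing y x := by
  rw [pairing_apply, P.graded_comm p q x y hx hy, map_smul]
  rfl

/-- Homogeneous components of a cocycle are cocycles, and the fundamental class kills those outside
degree n. So projecting to degree n first changes nothing, which links the pairing on the algebra
with the nondegenerate one on cohomology. -/
theorem integral_cocycle (z : P.cocycles) :
    P.integral z = P.fund (P.coboundaries.mkQ z) := by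
  classical
  have hz : ∀ k, P.d (DirectSum.decompose 𝒜 (z : A) k : A) = 0 := fun k => by
    have : P.d (z : A) = 0 := z.2
    rw [← decompose_d, this]
    simp
  have hsum : z = ∑ k ∈ (DirectSum.decompose 𝒜 (z : A)).support,
      (⟨(DirectSum.decompose 𝒜 (z : A) k : A), hz k⟩ : P.cocycles) :=
    Subtype.ext (by
      rw [AddSubmonoidClass.coe_finsetSum]
      exact (DirectSum.sum_support_decompose 𝒜 (z : A)).symm)
  rw [hsum, AddSubmonoidClass.coe_finsetSum, map_sum, map_sum, map_sum]
  refine Finset.sum_congr rfl fun k _ => ?_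
  have hk := SetLike.coe_mem (DirectSum.decompose 𝒜 (z : A) k)
  by_cases h : k = n
  · subst h
    have : P.topCocycle (DirectSum.decompose 𝒜 (z : A) (n : ℤ) : A) =
        (⟨(DirectSum.decompose 𝒜 (z : A) (n : ℤ) : A), hz _⟩ : P.cocycles) :=
      Subtype.ext (by rw [coe_topCocycle, DirectSum.decompose_of_mem_same 𝒜 hk])
    simp only [integral, LinearMap.comp_apply, this]
  · rw [P.integral_of_mem h hk, P.fund_eq_zero k h]
    exact ⟨_, hk, rfl⟩

end PDGCA

namespace HodgeHomotopy

variable {P : PDGCA 𝒜 n} (δ : HodgeHomotopy P)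

theorem eq_hodge (x : A) : x = δ.proj x + P.d (δ.dm x) + δ.dm (P.d x) := by
  rw [proj_apply]
  abel

theorem pairing_proj_dm (x y : A) : P.pairing (δ.proj x) (δ.dm y) = 0 := δ.orth_proj x y

theorem pairing_dm_proj (x y : A) : P.pairing (δ.dm x) (δ.proj y) = 0 := by
  induction x using DirectSum.Decomposition.inductionOn 𝒜 with
  | zero => simp
  | @homogeneous i m =>
    induction y using DirectSum.Decomposition.inductionOn 𝒜 with
    | zero => simp
    | @homogeneous j m' =>
      rw [P.pairing_symm (δ.dm_mem _ _ m.2) (δ.proj_mem m'.2), pairing_proj_dm, mul_zero]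
    | add a b ha hb => rw [map_add, map_add, ha, hb, add_zero]
  | add a b ha hb => rw [map_add, map_add, LinearMap.add_apply, ha, hb, add_zero]

/-- `d⁻` is selfadjoint up to sign. -/
theorem pairing_dm_left (x y : A) :
    P.pairing (δ.dm x) y = P.pairing (signTwist 𝒜 1 x) (δ.dm y) := by
  -- Of the three Hodge components of y, only d d⁻y can pair nontrivially with Im d⁻.
  have h1 : P.pairing (δ.dm x) y = P.pairing (δ.dm x) (P.d (δ.dm y)) := by
    conv_lhs => rw [δ.eq_hodge y]
    rw [map_add, map_add, pairing_dm_proj, δ.orth_dm, zero_add, add_zero]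
  have h2 : P.pairing (signTwist 𝒜 1 x) (δ.dm y) =
      P.pairing (P.d (δ.dm (signTwist 𝒜 1 x))) (δ.dm y) := by
    conv_lhs => rw [δ.eq_hodge (signTwist 𝒜 1 x)]
    rw [map_add, map_add, LinearMap.add_apply, LinearMap.add_apply, pairing_proj_dm, δ.orth_dm,
      zero_add, add_zero]
  -- Stokes for d⁻τx · d⁻y compares the two reduced pairings.
  have h3 := P.integral_d (δ.dm (signTwist 𝒜 1 x) * δ.dm y)
  have e : signTwist 𝒜 1 (δ.dm (signTwist 𝒜 1 x)) = - δ.dm x := by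
    rw [dm_signTwist, map_neg, signTwist_signTwist]
  rw [P.d_mul, e, neg_mul, map_add, map_neg, ← sub_eq_add_neg, sub_eq_zero] at h3
  rw [h1, h2, P.pairing_apply, P.pairing_apply, h3]

/-- The difference x - πx is d d⁻x + d⁻dx. The first summand is orthogonal to closed elements by
Stokes, the second to harmonic ones by the orthogonality of Im π and Im d⁻. -/
theorem pairing_proj_left (x y : A) (hy : y ∈ δ.harmonic) :
    P.pairing (δ.proj x) y = P.pairing x y := by
  obtain ⟨z, rfl⟩ := hy
  conv_rhs => rw [δ.eq_hodge x]
  have h := P.integral_d (δ.dm x * δ.proj z)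
  rw [P.d_mul, δ.d_proj, mul_zero, add_zero] at h
  rw [map_add, map_add, LinearMap.add_apply, LinearMap.add_apply, pairing_dm_proj, add_zero,
    P.pairing_apply (P.d _), h, add_zero]

/-! ### The A∞ relations without signs -/

section AInfinity

theorem d_treeWord {w : List A} (hw : ∀ x ∈ w, P.d x = 0) :
    P.d (δ.treeWord w) = δ.hatWord w - (δ.proj (δ.hatWord w) + δ.dm (P.d (δ.hatWord w))) := by
  have h : P.d (letter w) = 0 := by
    match w with
    | [] => simp [letter]
    | [x] => simpa [letter] using hw
    | x :: y :: w => simp [letter]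
  rw [treeWord_eq, map_add, h, zero_add, proj_apply]
  abel

/-- Substitute dG = M - E in d(τG * G), where E = πM + d⁻dM. Since τM = G * τG, the terms without E
are -(G * τG) * G + G * (τG * G), which vanish by associativity. -/
theorem d_hatWord {w : List A} (hw : ∀ x ∈ w, P.d x = 0) :
    P.d (δ.hatWord w) =
      conv (fun u => signTwist 𝒜 1 (δ.proj (δ.hatWord u) + δ.dm (P.d (δ.hatWord u))))
        δ.treeWord w -
      conv δ.treeWord (fun u => δ.proj (δ.hatWord u) + δ.dm (P.d (δ.hatWord u))) w := by
  set E : List A → A := fun u => δ.proj (δ.hatWord u) + δ.dm (P.d (δ.hatWord u)) with hE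
  have hτ : ∀ u, signTwist 𝒜 1 (δ.hatWord u) =
      conv δ.treeWord (fun v => signTwist 𝒜 1 (δ.treeWord v)) u := by
    intro u
    rw [hatWord, conv, map_splitSum]
    simp only [signTwist_mul, signTwist_signTwist]
    rfl
  have h1 : P.d (δ.hatWord w) =
      conv (fun u => P.d (signTwist 𝒜 1 (δ.treeWord u))) δ.treeWord w +
        conv δ.treeWord (fun u => P.d (δ.treeWord u)) w := by
    rw [hatWord, conv, map_splitSum]
    simp only [P.d_mul, signTwist_signTwist, splitSum_add]
    rfl
  have h2 : conv (fun u => P.d (signTwist 𝒜 1 (δ.treeWord u))) δ.treeWord w =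
      conv (fun u => signTwist 𝒜 1 (E u) + -
        conv δ.treeWord (fun v => signTwist 𝒜 1 (δ.treeWord v)) u) δ.treeWord w := by
    refine conv_congr fun u v huv => ?_
    rw [P.d_signTwist, δ.d_treeWord (fun x hx => hw x (by simp [← huv, hx])), ← hτ, map_sub, neg_sub, sub_eq_add_neg]
  have h3 : conv δ.treeWord (fun u => P.d (δ.treeWord u)) w =
      conv δ.treeWord (fun u => δ.hatWord u + - E u) w := by
    refine conv_congr fun u v huv => ?_
    rw [δ.d_treeWord (fun x hx => hw x (by simp [← huv, hx])), sub_eq_add_neg]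
  rw [h1, h2, h3, conv_add_left, conv_add_right, conv_neg_left, conv_neg_right, conv_assoc]
  rw [← hatWord]
  abel

/-- The transferred operations, without signs. -/
def projWord (w : List A) : A := δ.proj (δ.hatWord w)

theorem insertSum_letter (θ : A → A) (w : List A) :
    insertSum δ.projWord θ letter w = δ.projWord w := by
  cases w with
  | nil => simp [insertSum, projWord]
  | cons a w =>
    rw [insertSum, insertSum_eq_zero _ _ (fun _ _ => rfl), add_zero, splitSum_eq_last]
    · rfl
    · intro u v _ hv
      obtain ⟨c, v, rfl⟩ := List.exists_cons_of_ne_nil hv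
      rfl

/-- By induction E = πM + d⁻dM is, on shorter words, the insertion of πM into G: the letter part of
G gives πM, and the d⁻M part gives d⁻dM. The formula of `d_hatWord` then becomes the Leibniz rule
for τG * G. The length bound suffices because a factor that is the whole word is multiplied by G of
the empty word. -/
theorem d_hatWord_eq_insertSum {w : List A} (hw : ∀ x ∈ w, P.d x = 0) :
    P.d (δ.hatWord w) = insertSum δ.projWord (fun x => - signTwist 𝒜 1 x) δ.hatWord w := by
  induction hl : w.length using Nat.strong_induction_on generalizing w with
  | _ l ih =>
    set θ : A → A := fun x => - signTwist 𝒜 1 x with hθ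
    have hE : ∀ u : List A, u.length < w.length → (∀ x ∈ u, P.d x = 0) →
        δ.proj (δ.hatWord u) + δ.dm (P.d (δ.hatWord u)) =
          insertSum δ.projWord θ δ.treeWord u := by
      intro u hu hu'
      have e : δ.treeWord = fun l => letter l + δ.dm (δ.hatWord l) := funext δ.treeWord_eq
      rw [ih _ (hl ▸ hu) hu' rfl, e, insertSum_add, insertSum_letter, map_insertSum]
      rfl
    have h1 : conv (fun u => signTwist 𝒜 1 (δ.proj (δ.hatWord u) + δ.dm (P.d (δ.hatWord u))))
        δ.treeWord w = conv (insertSum δ.projWord θ fun u => signTwist 𝒜 1 (δ.treeWord u))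
          δ.treeWord w := by
      refine conv_congr fun u v huv => ?_
      by_cases hv : v = []
      · simp [hv]
      · have := List.length_pos_of_ne_nil hv
        rw [hE u (by rw [← huv, List.length_append]; omega)
          (fun x hx => hw x (by simp [← huv, hx])), map_insertSum]
    have h2 : conv δ.treeWord (fun u => δ.proj (δ.hatWord u) + δ.dm (P.d (δ.hatWord u))) w =
        conv δ.treeWord (insertSum δ.projWord θ δ.treeWord) w := by
      refine conv_congr fun u v huv => ?_
      by_cases hu : u = []
      · simp [hu]
      · have := List.length_pos_of_ne_nil hu
        rw [hE v (by rw [← huv, List.length_append]; omega)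
          (fun x hx => hw x (by simp [← huv, hx]))]
    -- The twist -τ of the left factor passes through G; the τ in front of G then cancels it up to
    -- the minus sign seen in `d_hatWord`.
    have h3 : conv (fun u => signTwist 𝒜 1 (δ.treeWord (u.map θ)))
        (insertSum δ.projWord θ δ.treeWord) w =
        - conv δ.treeWord (insertSum δ.projWord θ δ.treeWord) w := by
      rw [← conv_neg_left]
      refine conv_congr fun u v _ => ?_
      rw [hθ, treeWord_neg_signTwist, map_neg, signTwist_signTwist]
    rw [d_hatWord δ hw, h1, h2, hatWord, insertSum_conv, h3, sub_eq_add_neg]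

theorem insertSum_projWord {w : List A} (hw : ∀ x ∈ w, P.d x = 0) :
    insertSum δ.projWord (fun x => - signTwist 𝒜 1 x) δ.projWord w = 0 := by
  have h := congrArg δ.proj (δ.d_hatWord_eq_insertSum hw)
  rw [proj_d, map_insertSum] at h
  exact h.symm

end AInfinity

/-! ### Cyclic invariance without signs -/

section Cyclic

theorem hatWord_cons (x : A) (w : List A) : δ.hatWord (x :: w) =
    conv (fun u => signTwist 𝒜 1 (δ.treeWord (x :: u))) δ.treeWord w := by
  rw [hatWord, conv_cons]
  simp

theorem hatWord_append_singleton (w : List A) (y : A) : δ.hatWord (w ++ [y]) =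
    conv (fun u => signTwist 𝒜 1 (δ.treeWord u)) (fun v => δ.treeWord (v ++ [y])) w := by
  rw [hatWord, conv_append_singleton]
  simp

theorem conv_letter_left (x : A) (g : List A → A) (w : List A) :
    conv (fun u => letter (x :: u)) g w = x * g w := by
  cases w with
  | nil => simp [conv_nil, letter]
  | cons a w =>
    rw [conv_cons, conv, splitSum_eq_zero]
    · simp [letter]
    · intros
      simp [letter]

theorem conv_letter_right (f : List A → A) (w : List A) (y : A) :
    conv f (fun v => letter (v ++ [y])) w = f w * y := by
  rw [conv, splitSum_eq_last]
  · rfl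
  · intro u v _ hv
    match v with
    | [a] => simp [letter]
    | a :: b :: v => simp [letter]

/-- Cyclic invariance of the transferred operations, without signs. -/
theorem pairing_hatWord_cyclic (x y : A) (w : List A) :
    P.pairing x (δ.hatWord (w ++ [y])) = P.pairing (signTwist 𝒜 1 (δ.hatWord (x :: w))) y := by
  set X : List A → A := fun u => δ.treeWord (x :: u) with hX
  set Y : List A → A := fun v => δ.treeWord (v ++ [y]) with hY
  set T : List A → A := fun u => signTwist 𝒜 1 (δ.treeWord u) with hT
  have hXe : ∀ u, X u = letter (x :: u) + δ.dm (δ.hatWord (x :: u)) := fun u => δ.treeWord_eq _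
  have hYe : ∀ v, Y v = letter (v ++ [y]) + δ.dm (δ.hatWord (v ++ [y])) := fun v =>
    δ.treeWord_eq _
  have hτ : ∀ u, signTwist 𝒜 1 (δ.hatWord (x :: u)) = conv X T u := by
    intro u
    rw [hatWord_cons, conv, map_splitSum]
    simp only [signTwist_mul, signTwist_signTwist]
    rfl
  -- Here T * Y is M on v y, and X * T is τM on x u, so on each factorization this is adjointness of
  -- d⁻.
  have hadj : P.integral (conv (fun u => δ.dm (δ.hatWord (x :: u))) (conv T Y) w) =
      P.integral (conv (conv X T) (fun v => δ.dm (δ.hatWord (v ++ [y]))) w) := by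
    rw [conv, conv, map_splitSum, map_splitSum]
    refine splitSum_congr fun u v _ => ?_
    rw [← hτ, ← P.pairing_apply, ← P.pairing_apply, pairing_dm_left, hatWord_append_singleton]
  have h1 : conv X (conv T Y) w = x * conv T Y w +
      conv (fun u => δ.dm (δ.hatWord (x :: u))) (conv T Y) w := by
    rw [← conv_letter_left, ← conv_add_left, ← funext hXe]
  have h2 : conv (conv X T) Y w = conv X T w * y +
      conv (conv X T) (fun v => δ.dm (δ.hatWord (v ++ [y]))) w := by
    rw [← conv_letter_right, ← conv_add_right, ← funext hYe]
  -- Two expansions of the same triple convolution; their d⁻ terms have equal integrals and drop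
  -- out.
  rw [conv_assoc, h1] at h2
  have h3 := congrArg P.integral h2
  rw [map_add, map_add, hadj, add_left_inj] at h3
  rw [hτ, hatWord_append_singleton, P.pairing_apply, P.pairing_apply, h3]

end Cyclic

/-! ### Vanishing on shuffles in shifted degrees -/

section Shuffle

/-- The Koszul sign of two elements of degrees `p - 1` and `q - 1`. -/
def shiftedSign (F : Type*) [Field F] {R : Type*} (q r : ℤ × R) : F :=
  (-1 : F) ^ ((q.1 - 1) * (r.1 - 1))

theorem sum_map_sub_one {R : Type*} (u : List (ℤ × R)) :
    (u.map fun q => q.1 - 1).sum = wordDegree u - u.length := by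
  induction u with
  | nil => simp [wordDegree]
  | cons a u ih => simp [ih, wordDegree]; ring

theorem crossSign_shiftedSign {R : Type*} (u v : List (ℤ × R)) :
    crossSign (shiftedSign F) u v =
      (-1 : F) ^ ((wordDegree u - u.length) * (wordDegree v - v.length)) := by
  rw [← sum_map_sub_one, ← sum_map_sub_one, ← crossSign_zpow]
  rfl

/-- In the shifted degrees p and q, graded commutativity of the product becomes graded antisymmetry
of τ(x)y. This cancels the two extreme terms of a shuffle. -/
theorem signTwist_mul_add_comm {p q : ℤ} {x y : A} (hx : x ∈ 𝒜 (p + 1)) (hy : y ∈ 𝒜 (q + 1))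
    (P : PDGCA 𝒜 n) :
    signTwist 𝒜 1 x * y + (-1 : F) ^ (p * q) • (signTwist 𝒜 1 y * x) = 0 := by
  rw [signTwist_one_apply 𝒜 hx, signTwist_one_apply 𝒜 hy, smul_mul_assoc, smul_mul_assoc,
    P.graded_comm _ _ y x hy hx, smul_smul, smul_smul, ← zpow_add₀ (by simp), ← zpow_add₀ (by simp),
    neg_one_zpow_eq_of_even_sub (a := p * q + (q + 1) + (q + 1) * (p + 1)) (b := p),
    zpow_add_one₀ (by simp)]
  · simp
  · exact ⟨p * q + q + 1, by ring⟩

theorem shuffleSum_hatWord_of_treeWord {u v : List (ℤ × A)} (hu : u ≠ []) (hv : v ≠ [])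
    (hu' : IsHomogeneousWord 𝒜 u) (hv' : IsHomogeneousWord 𝒜 v)
    (h : ∀ u' v' : List (ℤ × A), u' ≠ [] → v' ≠ [] → IsHomogeneousWord 𝒜 u' →
      IsHomogeneousWord 𝒜 v' → u'.length + v'.length < u.length + v.length →
      shuffleSum (shiftedSign F) (fun l => δ.treeWord (l.map Prod.snd)) u' v' = 0) :
    shuffleSum (shiftedSign F) (fun l => δ.hatWord (l.map Prod.snd)) u v = 0 := by
  have e : (fun l : List (ℤ × A) => δ.hatWord (l.map Prod.snd)) =
      conv (fun l => signTwist 𝒜 1 (δ.treeWord (l.map Prod.snd)))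
        (fun l => δ.treeWord (l.map Prod.snd)) := by
    funext l
    rw [hatWord, conv_map]
  rw [e, shuffleSum_conv_of_vanish _ _ _ _ _ hu hv (by simp) (by simp)]
  · have h1 := δ.treeWord_mem hu'
    have h2 := δ.treeWord_mem hv'
    rw [add_sub_right_comm] at h1 h2
    rw [crossSign_shiftedSign]
    exact signTwist_mul_add_comm h1 h2 P
  · rintro u' v' hu1 hv1 ⟨u'', v'', rfl, rfl, hne⟩
    rw [← map_shuffleSum, h u' v' hu1 hv1 (fun q hq => hu' q (by simp [hq]))
      (fun q hq => hv' q (by simp [hq])), map_zero]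
    simp only [List.length_append]
    rcases hne with hne | hne <;> (have := List.length_pos_of_ne_nil hne; omega)
  · rintro u' v' hu1 hv1 ⟨u'', v'', rfl, rfl, hne⟩
    refine h u' v' hu1 hv1 (fun q hq => hu' q (by simp [hq])) (fun q hq => hv' q (by simp [hq])) ?_
    simp only [List.length_append]
    rcases hne with hne | hne <;> (have := List.length_pos_of_ne_nil hne; omega)

/-- Induction on the total length. Both words being nonempty, every shuffle has at least two
letters, so `treeWord` is d⁻ of `hatWord` on it and the letter part never enters. -/
theorem shuffleSum_treeWord {u v : List (ℤ × A)} (hu : u ≠ []) (hv : v ≠ [])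
    (hu' : IsHomogeneousWord 𝒜 u) (hv' : IsHomogeneousWord 𝒜 v) :
    shuffleSum (shiftedSign F) (fun l => δ.treeWord (l.map Prod.snd)) u v = 0 := by
  induction hl : u.length + v.length using Nat.strong_induction_on generalizing u v with
  | _ l ih =>
    have := List.length_pos_of_ne_nil hu
    have := List.length_pos_of_ne_nil hv
    rw [shuffleSum_congr (g := fun l => δ.dm (δ.hatWord (l.map Prod.snd))), ← map_shuffleSum,
      δ.shuffleSum_hatWord_of_treeWord hu hv hu' hv'
        fun u' v' h1 h2 h3 h4 h5 => ih _ (hl ▸ h5) h1 h2 h3 h4 rfl, map_zero]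
    intro l hl
    exact δ.treeWord_of_two_le (by rw [List.length_map]; omega)

theorem shuffleSum_hatWord {u v : List (ℤ × A)} (hu : u ≠ []) (hv : v ≠ [])
    (hu' : IsHomogeneousWord 𝒜 u) (hv' : IsHomogeneousWord 𝒜 v) :
    shuffleSum (shiftedSign F) (fun l => δ.hatWord (l.map Prod.snd)) u v = 0 :=
  δ.shuffleSum_hatWord_of_treeWord hu hv hu' hv' fun _ _ h1 h2 h3 h4 _ =>
    δ.shuffleSum_treeWord h1 h2 h3 h4

end Shuffle

end HodgeHomotopy

end DGCA

/-! ### Signs: from the stated recursion to the sign-free one -/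

/-- The exponent of the sign that relates the transferred operations with and without signs:
`k + ∑ (k - i) p_i`. -/
def signExp : List ℤ → ℤ
  | [] => 0
  | p :: ps => 1 + p * ps.length + signExp ps

theorem signExp_append (u v : List ℤ) :
    signExp (u ++ v) = signExp u + signExp v + v.length * u.sum := by
  induction u with
  | nil => simp [signExp]
  | cons p u ih => simp [signExp, ih]; ring

theorem take_ofFn {α : Type*} {n i m : ℕ} (h : i + m = n) (x : Fin n → α) :
    (List.ofFn x).take i = List.ofFn fun j : Fin i => x ⟨j, by omega⟩ := by
  subst h
  apply List.ext_getElem <;> simp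

theorem drop_ofFn {α : Type*} {n i m : ℕ} (h : i + m = n) (x : Fin n → α) :
    (List.ofFn x).drop i = List.ofFn fun j : Fin m => x ⟨i + j, by omega⟩ := by
  subst h
  apply List.ext_getElem <;> simp

theorem wordDegree_ofFn {R : Type*} {n : ℕ} (z : Fin n → ℤ × R) :
    HodgeHomotopy.wordDegree (List.ofFn z) = ∑ i, (z i).1 := by
  simp [HodgeHomotopy.wordDegree, List.map_ofFn, List.sum_ofFn]

theorem HodgeHomotopy.isHomogeneousWord_ofFn {F A : Type*} [Field F] [Ring A] [Algebra F A]
    {𝒜 : ℤ → Submodule F A} {k : ℕ} {z : Fin k → ℤ × A}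
    (hz : ∀ i, (z i).2 ∈ 𝒜 (z i).1) : IsHomogeneousWord 𝒜 (List.ofFn z) := by
  intro q hq
  obtain ⟨i, rfl⟩ := (List.mem_ofFn' _ _).1 hq
  exact hz i

theorem neg_neg_one_zpow {F : Type*} [Field F] (e : ℤ) : - (-1 : F) ^ e = (-1 : F) ^ (1 + e) := by
  rw [zpow_add₀ (by simp)]
  simp

section DGCA

variable {F : Type*} [Field F] {A : Type*} [Ring A] [Algebra F A]
  {𝒜 : ℤ → Submodule F A} [GradedAlgebra 𝒜] {n : ℕ}

namespace HodgeHomotopy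

variable {P : PDGCA 𝒜 n} (δ : HodgeHomotopy P)

theorem signExp_smul_signTwist_mul (u v : List (ℤ × A)) (hu : IsHomogeneousWord 𝒜 u) :
    (-1 : F) ^ signExp ((u ++ v).map Prod.fst) •
      (signTwist 𝒜 1 (δ.treeWord (u.map Prod.snd)) * δ.treeWord (v.map Prod.snd)) =
    (-1 : F) ^ (signExp (u.map Prod.fst) + signExp (v.map Prod.fst) +
      (v.length + 1) * wordDegree u + 1 - u.length) •
      (δ.treeWord (u.map Prod.snd) * δ.treeWord (v.map Prod.snd)) := by
  rw [signTwist_one_apply 𝒜 (δ.treeWord_mem hu), smul_mul_assoc, smul_smul,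
    ← zpow_add₀ (by simp)]
  congr 2
  rw [List.map_append, signExp_append, List.length_map, wordDegree]
  ring

theorem hat_eq_hatWord (k : ℕ) (z : Fin (k + 2) → ℤ × A) (hz : ∀ i, (z i).2 ∈ 𝒜 (z i).1) :
    δ.hat (k + 2) (fun i => (z i).2) = (-1 : F) ^ signExp ((List.ofFn z).map Prod.fst) •
      δ.hatWord ((List.ofFn z).map Prod.snd) := by
  induction k using Nat.strong_induction_on with
  | _ k ih =>
    match k with
    | 0 =>
      rw [hat_two]
      simp [hatWord, conv_cons, conv_nil, signExp, signTwist_one_apply 𝒜 (hz 0), smul_smul,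
        zpow_add₀, ← mul_zpow]
    | k + 1 =>
      have hdm : ∀ j < k + 1, ∀ z : Fin (j + 2) → ℤ × A, (∀ i, (z i).2 ∈ 𝒜 (z i).1) →
          δ.dm (δ.hat (j + 2) (fun i => (z i).2)) =
          (-1 : F) ^ signExp ((List.ofFn z).map Prod.fst) •
            δ.treeWord ((List.ofFn z).map Prod.snd) := by
        intro j hj z hz
        rw [ih j hj z hz, map_smul, treeWord_of_two_le _ (by simp)]
      set w := List.ofFn z with hw
      have hlen : w.length = k + 3 := by simp [hw]
      have hhom : ∀ i, IsHomogeneousWord 𝒜 (w.take i) := fun i q hq =>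
        isHomogeneousWord_ofFn hz q (List.mem_of_mem_take hq)
      have hterm : ∀ s t, s + t = k + 3 → (-1 : F) ^ signExp (w.map Prod.fst) •
          (signTwist 𝒜 1 (δ.treeWord ((w.take s).map Prod.snd)) *
            δ.treeWord ((w.drop s).map Prod.snd)) =
          (-1 : F) ^ (signExp ((w.take s).map Prod.fst) + signExp ((w.drop s).map Prod.fst) +
            (t + 1) * wordDegree (w.take s) + 1 - s) •
            (δ.treeWord ((w.take s).map Prod.snd) * δ.treeWord ((w.drop s).map Prod.snd)) := by
        intro s t h
        have := δ.signExp_smul_signTwist_mul (w.take s) (w.drop s) (hhom s)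
        rw [List.take_append_drop] at this
        rw [this]
        congr 3
        · rw [List.length_drop, hlen]
          congr 3
          omega
        · rw [List.length_take, hlen]
          congr 1
          omega
      -- Of the k + 4 factorizations, the two with an empty factor vanish. Those cutting off the
      -- last or the first letter match the first two terms of the recursion, and the k others match
      -- its sum.
      rw [hatWord, conv_map, conv, splitSum, Finset.smul_sum, hlen, Finset.sum_range_succ,
        Finset.sum_range_succ, Finset.sum_range_succ', Finset.sum_range_succ',
        δ.hat_apply k (fun i => (z i).1) _ hz]
      have hlast : (-1 : F) ^ (k + 2) •
            (δ.dm (δ.hat (k + 2) fun j => (z j.castSucc).2) * (z (Fin.last (k + 2))).2) =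
          (-1 : F) ^ signExp (w.map Prod.fst) •
          (signTwist 𝒜 1 (δ.treeWord ((w.take (k + 2)).map Prod.snd)) *
            δ.treeWord ((w.drop (k + 2)).map Prod.snd)) := by
        rw [hterm (k + 2) 1 (by omega), hw, take_ofFn (m := 1) (by omega),
          drop_ofFn (m := 1) (by omega), wordDegree_ofFn,
          hdm k (by omega) (fun j => z j.castSucc) (fun j => hz _), smul_mul_assoc, smul_smul,
          ← zpow_natCast, ← zpow_add₀ (by simp)]
        congr 1
        · apply neg_one_zpow_eq_of_even_sub
          simp only [List.ofFn_succ, List.ofFn_zero, signExp, List.map_cons, List.map_nil,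
            List.length_nil]
          refine ⟨k + 1 - ∑ i : Fin (k + 2), (z ⟨i, by omega⟩).1, ?_⟩
          push_cast
          have e : ∀ i : Fin (k + 2), i.castSucc = (⟨i, by omega⟩ : Fin (k + 3)) := fun _ => rfl
          simp only [e]
          ring
        · congr 1
          simp
          rfl
      have hfirst : (-1 : F) ^ (((k : ℤ) + 3) * (z 0).1) •
            ((z 0).2 * δ.dm (δ.hat (k + 2) fun j => (z j.succ).2)) =
          - (-1 : F) ^ signExp (w.map Prod.fst) •
          (signTwist 𝒜 1 (δ.treeWord ((w.take 1).map Prod.snd)) *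
            δ.treeWord ((w.drop 1).map Prod.snd)) := by
        rw [neg_smul, hterm 1 (k + 2) (by omega), ← neg_smul, neg_neg_one_zpow, hw, List.ofFn_succ, List.drop_one, List.tail_cons,
          hdm k (by omega) (fun j => z j.succ) (fun j => hz _), mul_smul_comm, smul_smul,
          ← zpow_add₀ (by simp)]
        congr 1
        · apply neg_one_zpow_eq_of_even_sub
          simp only [wordDegree, List.take_succ_cons, List.take_zero, signExp, List.map_cons,
            List.map_nil, List.length_nil, List.sum_cons, List.sum_nil]
          refine ⟨-1, ?_⟩
          push_cast
          ring
        · simp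
      have hmid : ∀ i : Fin k,
          (-1 : F) ^ (((i : ℤ) + 2) + ((k : ℤ) - i) * ∑ j : Fin (i + 2), (z ⟨j, by omega⟩).1) •
          (δ.dm (δ.hat (i + 2) fun j => (z ⟨j, by omega⟩).2) *
            δ.dm (δ.hat (k + 1 - i) fun j => (z ⟨i + 2 + j, by omega⟩).2)) =
          - (-1 : F) ^ signExp (w.map Prod.fst) •
          (signTwist 𝒜 1 (δ.treeWord ((w.take (i + 1 + 1)).map Prod.snd)) *
            δ.treeWord ((w.drop (i + 1 + 1)).map Prod.snd)) := by
        intro i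
        obtain ⟨i, hi⟩ := i
        obtain ⟨c, rfl⟩ : ∃ c, k = i + 1 + c := ⟨k - i - 1, by omega⟩
        have hc : i + 1 + c + 1 - i = c + 2 := by omega
        have hd : δ.dm (δ.hat (i + 1 + c + 1 - i) fun j => (z ⟨i + 2 + j, by omega⟩).2) =
            δ.dm (δ.hat (c + 2) fun j => (z ⟨i + 2 + j, by omega⟩).2) := by
          -- The arity `k + 1 - i` equals c + 2 only propositionally, so it is generalized before
          -- being substituted.
          congr 1
          generalize_proofs h1 h2
          revert h1 h2
          generalize i + 1 + c + 1 - i = e at hc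
          subst hc
          intros
          rfl
        dsimp only
        rw [neg_smul, hterm (i + 1 + 1) (c + 2) (by omega), ← neg_smul, neg_neg_one_zpow, hd, hw, take_ofFn (m := c + 2) (by omega),
          drop_ofFn (m := c + 2) (by omega), wordDegree_ofFn,
          hdm i (by omega) (fun j => z ⟨j, by omega⟩) (fun j => hz _),
          hdm c (by omega) (fun j => z ⟨i + 2 + j, by omega⟩) (fun j => hz _),
          smul_mul_smul_comm, smul_smul, ← zpow_add₀ (by simp), ← zpow_add₀ (by simp)]
        congr 1
        apply neg_one_zpow_eq_of_even_sub
        refine ⟨i + 1 - ∑ j : Fin (i + 2), (z ⟨j, by omega⟩).1, ?_⟩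
        push_cast
        ring
      rw [hlast, hfirst, Finset.sum_congr rfl fun i _ => hmid i,
        Fin.sum_univ_eq_sum_range (fun i => - (-1 : F) ^ signExp (w.map Prod.fst) •
          (signTwist 𝒜 1 (δ.treeWord ((w.take (i + 1 + 1)).map Prod.snd)) *
            δ.treeWord ((w.drop (i + 1 + 1)).map Prod.snd)))]
      have hall : w.drop (k + 3) = [] := List.drop_of_length_le hlen.le
      simp only [neg_smul, Finset.sum_neg_distrib, List.take_zero, List.map_nil, treeWord_nil,
        map_zero, zero_mul, smul_zero, hall, mul_zero, zero_add, add_zero]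
      abel

end HodgeHomotopy

end DGCA

/-- A shuffle sum whose terms carry the signs `signExp` is, up to an overall sign, a shuffle sum with
shifted Koszul signs. -/
theorem shuffleSum_signExp {F R M : Type*} [Field F] [AddCommGroup M] [Module F M]
    (f : List (ℤ × R) → M) (u v : List (ℤ × R)) :
    shuffleSum (fun q r => (-1 : F) ^ (1 + q.1 * r.1))
        (fun l => (-1 : F) ^ signExp (l.map Prod.fst) • f l) u v =
      (-1 : F) ^ signExp ((u ++ v).map Prod.fst) •
        shuffleSum (HodgeHomotopy.shiftedSign F) f u v := by
  have hsmul : ∀ (c : F) (κ : ℤ × R → ℤ × R → F) (k : List (ℤ × R) → M) (u v : List (ℤ × R)),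
      shuffleSum κ (fun l => c • k l) u v = c • shuffleSum κ k u v := fun c κ k u v =>
    (map_shuffleSum (c • LinearMap.id) κ k u v).symm
  -- Beyond `signExp l`, the exponent for a :: l depends only on the degree of a and the length of
  -- l, which is constant on a shuffle sum.
  have hcons : ∀ (a : ℤ × R) (u v : List (ℤ × R)) (k : List (ℤ × R) → M),
      shuffleSum (fun q r => (-1 : F) ^ (1 + q.1 * r.1))
        (fun l => (-1 : F) ^ signExp ((a :: l).map Prod.fst) • k l) u v =
      (-1 : F) ^ (1 + a.1 * (u.length + v.length)) •
        shuffleSum (fun q r => (-1 : F) ^ (1 + q.1 * r.1))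
          (fun l => (-1 : F) ^ signExp (l.map Prod.fst) • k l) u v := by
    intro a u v k
    rw [← hsmul]
    refine shuffleSum_congr _ _ _ fun l hl => ?_
    rw [smul_smul, ← zpow_add₀ (by simp), List.map_cons, signExp, List.length_map, hl]
    push_cast
    rfl
  have hcross : ∀ (u : List (ℤ × R)) (b : ℤ × R),
      crossSign (fun q r => (-1 : F) ^ (1 + q.1 * r.1)) u [b] =
        (-1 : F) ^ (u.length + (u.map Prod.fst).sum * b.1) := by
    intro u b
    induction u with
    | nil => simp [crossSign]
    | cons a u ih =>
      rw [crossSign_cons_left, ih]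
      simp only [crossSign, List.map_cons, List.map_nil, List.prod_cons, List.prod_nil, mul_one,
        List.length_cons, List.sum_cons]
      rw [← zpow_add₀ (by simp)]
      congr 1
      push_cast
      ring
  induction u, v using shuffle_induction generalizing f with
  | nil_left v => simp [shuffleSum_nil_left]
  | nil_right u => simp [shuffleSum_nil_right]
  | cons_cons a u b v hu hv =>
    rw [shuffleSum_cons_cons, shuffleSum_cons_cons, hcons, hcons, hu, hv, hcross,
      HodgeHomotopy.crossSign_shiftedSign, smul_add, smul_smul, smul_smul, smul_smul, smul_smul]
    simp only [← zpow_add₀ (show (-1 : F) ≠ 0 by simp)]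
    congr 2
    · congr 1
      simp only [List.cons_append, List.map_cons, signExp, List.length_map, List.length_append,
        List.length_cons]
      push_cast
      ring
    · apply neg_one_zpow_eq_of_even_sub
      simp only [List.map_append, signExp_append, List.map_cons, signExp, List.length_map,
        List.length_cons, HodgeHomotopy.wordDegree, List.map_nil, List.sum_cons, List.sum_nil,
        List.length_nil]
      push_cast
      set S := a.1 + (u.map Prod.fst).sum
      set U : ℤ := (u.length : ℤ)
      refine ⟨b.1 * (U + 1), ?_⟩
      ring

theorem ofFn_insert {β : Type*} (f : ℕ → β) (c : β) {N s r : ℕ} (hs : 1 ≤ s) (h : r + s ≤ N) :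
    (List.ofFn fun i : Fin (N - s + 1) =>
      if (i : ℕ) < r then f i else if (i : ℕ) = r then c else f (i + s - 1)) =
    ((List.range N).map f).take r ++ c :: ((List.range N).map f).drop (r + s) := by
  apply List.ext_getElem
  · simp; omega
  · intro i h1 h2
    simp only [List.length_ofFn] at h1
    simp only [List.getElem_ofFn, List.getElem_append, List.length_take, List.length_map,
      List.length_range, List.getElem_cons, List.getElem_take, List.getElem_drop,
      List.getElem_map, List.getElem_range]
    by_cases hi : i < r
    · simp [hi, show i < min r N by omega]
    · by_cases hi' : i = r
      · simp [hi', show min r N = r by omega]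
      · rw [if_neg hi, if_neg hi', dif_neg (by omega), dif_neg (by omega)]
        congr 1
        omega

theorem ofFn_segment {β : Type*} (f : ℕ → β) {N s r : ℕ} (h : r + s ≤ N) :
    (List.ofFn fun a : Fin s => f (r + a)) = (((List.range N).map f).drop r).take s := by
  apply List.ext_getElem
  · simp; omega
  · intro i h1 h2
    simp

/-! ### The minimal C∞-structure on the harmonic subspace -/

section DGCA

variable {F : Type*} [Field F] {A : Type*} [Ring A] [Algebra F A]
  {𝒜 : ℤ → Submodule F A} [GradedAlgebra 𝒜] {n : ℕ}

namespace HodgeHomotopy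

variable {P : PDGCA 𝒜 n} (δ : HodgeHomotopy P)

theorem mem_harmonicGrading {k : ℤ} {x : δ.harmonic} :
    x ∈ δ.harmonicGrading k ↔ (x : A) ∈ 𝒜 k := Iff.rfl

theorem coe_m (k : ℕ) (x : Fin k → δ.harmonic) :
    (δ.m k x : A) = δ.proj (δ.hat k fun i => (x i : A)) := rfl

theorem m_one : δ.m 1 = 0 := by
  ext x
  rw [coe_m, hat]
  exact δ.proj_d _

theorem m_zero : δ.m 0 = 0 := by
  ext x
  rw [coe_m, hat]
  simp

/-- Arity one is included although `hat 1` is d while `hatWord` is 0 on a single letter: πd = 0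
makes both sides vanish. -/
theorem coe_m_eq (k : ℕ) (p : Fin k → ℤ) (x : Fin k → δ.harmonic)
    (hx : ∀ i, x i ∈ δ.harmonicGrading (p i)) :
    (δ.m k x : A) = (-1 : F) ^ signExp (List.ofFn p) •
      δ.projWord (List.ofFn fun i => (x i : A)) := by
  match k with
  | 0 => simp [m_zero, projWord]
  | 1 => simp [m_one, projWord]
  | k + 2 =>
    rw [coe_m, δ.hat_eq_hatWord k (fun i => (p i, (x i : A))) hx, map_smul, List.map_ofFn,
      List.map_ofFn]
    rfl

theorem m_mem (k : ℕ) (p : Fin k → ℤ) (x : Fin k → δ.harmonic)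
    (hx : ∀ i, x i ∈ δ.harmonicGrading (p i)) :
    δ.m k x ∈ δ.harmonicGrading (∑ i, p i + 2 - k) := by
  rw [mem_harmonicGrading, δ.coe_m_eq k p x hx]
  refine Submodule.smul_mem _ _ (δ.proj_mem ?_)
  have h := δ.hatWord_mem (w := List.ofFn fun i => (p i, (x i : A))) (isHomogeneousWord_ofFn hx)
  rw [wordDegree_ofFn, List.map_ofFn, List.length_ofFn] at h
  exact h

/-- π preserves degrees, so the homogeneous components of a harmonic element are harmonic;
independence is inherited from the ambient grading. -/
theorem isInternal_harmonicGrading : DirectSum.IsInternal δ.harmonicGrading := by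
  classical
  rw [DirectSum.isInternal_submodule_iff_iSupIndep_and_iSup_eq_top]
  constructor
  · rw [iSupIndep_iff_finsetSum_eq_zero_imp_eq_zero]
    have hA := (DirectSum.Decomposition.isInternal 𝒜).submodule_iSupIndep
    rw [iSupIndep_iff_finsetSum_eq_zero_imp_eq_zero] at hA
    intro s v hv hsum i hi
    have h := hA s (fun i => (v i : A)) (fun i hi => hv i hi) (by
      rw [← AddSubmonoidClass.coe_finsetSum, hsum]
      rfl) i hi
    exact Subtype.ext h
  · rw [eq_top_iff]
    intro x _
    have hcomp : ∀ k, δ.proj (DirectSum.decompose 𝒜 (x : A) k : A) =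
        (DirectSum.decompose 𝒜 (x : A) k : A) := by
      intro k
      have hproj : ∀ y : A, (DirectSum.decompose 𝒜 (δ.proj y) k : A) =
          δ.proj (DirectSum.decompose 𝒜 y k : A) := by
        intro y
        induction y using DirectSum.Decomposition.inductionOn 𝒜 with
        | zero => simp
        | @homogeneous i m =>
          by_cases h : i = k
          · subst h
            rw [DirectSum.decompose_of_mem_same 𝒜 m.2,
              DirectSum.decompose_of_mem_same 𝒜 (δ.proj_mem m.2)]
          · rw [DirectSum.decompose_of_mem_ne 𝒜 m.2 h,
              DirectSum.decompose_of_mem_ne 𝒜 (δ.proj_mem m.2) h, map_zero]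
        | add a b ha hb =>
          simp only [map_add, DirectSum.decompose_add, DirectSum.add_apply, Submodule.coe_add,
            ha, hb]
      rw [← hproj, proj_harmonic]
    have hx : x = ∑ k ∈ (DirectSum.decompose 𝒜 (x : A)).support,
        (⟨(DirectSum.decompose 𝒜 (x : A) k : A), _, hcomp k⟩ : δ.harmonic) :=
      Subtype.ext (by
        rw [AddSubmonoidClass.coe_finsetSum]
        exact (DirectSum.sum_support_decompose 𝒜 (x : A)).symm)
    rw [hx]
    refine Submodule.sum_mem _ fun k _ => Submodule.mem_iSup_of_mem k ?_
    exact SetLike.coe_mem (DirectSum.decompose 𝒜 (x : A) k)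

theorem projWord_smul (w : List (F × A)) : δ.projWord (w.map fun q => q.1 • q.2) =
    (w.map Prod.fst).prod • δ.projWord (w.map Prod.snd) := by
  rw [projWord, hatWord_smul, map_smul, projWord]

theorem projWord_smul_letter (c : F) (u v : List A) (x : A) :
    δ.projWord (u ++ (c • x) :: v) = c • δ.projWord (u ++ x :: v) := by
  have h := δ.projWord_smul (u.map (fun y => (1, y)) ++ (c, x) :: v.map (fun y => (1, y)))
  simpa [Function.comp_def] using h

/-- On homogeneous letters -τ is a scalar, so multilinearity collects the twist of a prefix into one
sign, the Koszul sign in the A∞ relation. -/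
theorem projWord_map_neg_signTwist (u : List (ℤ × A)) (hu : IsHomogeneousWord 𝒜 u) (v : List A) :
    δ.projWord ((u.map Prod.snd).map (fun x => - signTwist 𝒜 1 x) ++ v) =
      (-1 : F) ^ (wordDegree u + u.length) • δ.projWord (u.map Prod.snd ++ v) := by
  have h := δ.projWord_smul (u.map (fun q => ((-1) ^ (q.1 + 1), q.2)) ++ v.map (fun y => (1, y)))
  have h1 : u.map (fun q => (-1 : F) ^ (q.1 + 1) • q.2) =
      (u.map Prod.snd).map (fun x => - signTwist 𝒜 1 x) := by
    rw [List.map_map]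
    refine List.map_congr_left fun q hq => ?_
    rw [Function.comp_apply, signTwist_one_apply 𝒜 (hu q hq), zpow_add_one₀ (by simp)]
    simp
  have h2 : (u.map fun q => (-1 : F) ^ (q.1 + 1)).prod = (-1 : F) ^ (wordDegree u + u.length) := by
    clear h h1 hu
    induction u with
    | nil => simp [wordDegree]
    | cons a u ih =>
      rw [List.map_cons, List.prod_cons, ih, ← zpow_add₀ (by simp)]
      congr 1
      simp only [wordDegree, List.map_cons, List.sum_cons, List.length_cons]
      push_cast
      ring
  simp only [List.map_append, List.map_map, Function.comp_def, one_smul, List.map_id'] at h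
  rw [h1] at h
  rw [h, List.prod_append, h2]
  simp

theorem m_relation (N : ℕ) (p : ℕ → ℤ) (x : ℕ → δ.harmonic)
    (hx : ∀ i, x i ∈ δ.harmonicGrading (p i)) :
    ∑ s ∈ Finset.Icc 1 N, ∑ r ∈ Finset.range (N - s + 1),
      (-1 : F) ^ ((r : ℤ) + s * ((N : ℤ) - r - s) + s * ∑ i ∈ Finset.range r, p i) •
        δ.m (N - s + 1) (fun i =>
          if (i : ℕ) < r then x i
          else if (i : ℕ) = r then δ.m s (fun a => x (r + a))
          else x (i + s - 1)) = 0 := by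
  set w : List A := (List.range N).map fun i => (x i : A) with hw
  set ps : List ℤ := (List.range N).map p with hps
  have hclosed : ∀ y ∈ w, P.d y = 0 := by
    intro y hy
    obtain ⟨i, _, rfl⟩ := List.mem_map.1 hy
    exact δ.d_harmonic _
  have hlw : w.length = N := by simp [hw]
  have h := δ.insertSum_projWord hclosed
  rw [insertSum_eq_sum, hlw] at h
  apply Subtype.val_injective
  -- The stated signs differ from the sign-free ones by a factor that depends only on the whole
  -- word, hence is common to all r and s.
  have h' := congrArg (fun y => (-1 : F) ^ (signExp ps + 1) • y) h
  simp only [smul_zero, Finset.smul_sum] at h'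
  rw [ZeroMemClass.coe_zero, ← h', AddSubmonoidClass.coe_finsetSum]
  refine Finset.sum_congr rfl fun s hs => ?_
  rw [AddSubmonoidClass.coe_finsetSum]
  refine Finset.sum_congr rfl fun r hr => ?_
  rw [Finset.mem_Icc] at hs
  rw [Finset.mem_range] at hr
  obtain ⟨hs1, hsN⟩ := hs
  have hrs : r + s ≤ N := by omega
  set q : ℤ := ∑ a : Fin s, p (r + a) + 2 - s with hq
  set B : δ.harmonic := δ.m s (fun a => x (r + a)) with hB
  have hBmem : B ∈ δ.harmonicGrading q :=
    δ.m_mem s (fun a => p (r + a)) (fun a => x (r + a)) fun a => hx _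
  have hBeq : (B : A) = (-1 : F) ^ signExp ((ps.drop r).take s) •
      δ.projWord ((w.drop r).take s) := by
    rw [hB, δ.coe_m_eq s (fun a => p (r + a)) (fun a => x (r + a)) fun a => hx _,
      ofFn_segment p hrs, ofFn_segment (fun i => (x i : A)) hrs]
  have hm : (δ.m (N - s + 1) (fun i => if (i : ℕ) < r then x i
      else if (i : ℕ) = r then B else x (i + s - 1)) : A) =
      (-1 : F) ^ signExp (ps.take r ++ q :: ps.drop (r + s)) •
        δ.projWord (w.take r ++ (B : A) :: w.drop (r + s)) := by
    rw [δ.coe_m_eq (N - s + 1) (fun i => if (i : ℕ) < r then p i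
      else if (i : ℕ) = r then q else p (i + s - 1)), ofFn_insert p q hs1 hrs, hw,
      ← ofFn_insert (fun i => (x i : A)) (B : A) hs1 hrs]
    · congr 3
      funext i
      split_ifs <;> rfl
    · intro i
      split_ifs
      · exact hx _
      · exact hBmem
      · exact hx _
  have hθ : δ.projWord ((w.take r).map (fun x => - signTwist 𝒜 1 x) ++
        δ.projWord ((w.drop r).take s) :: w.drop (r + s)) =
      (-1 : F) ^ (∑ i ∈ Finset.range r, p i + r) • δ.projWord (w.take r ++
        δ.projWord ((w.drop r).take s) :: w.drop (r + s)) := by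
    have h1 := δ.projWord_map_neg_signTwist ((List.range r).map fun i => (p i, (x i : A))) (by
      intro y hy
      obtain ⟨i, _, rfl⟩ := List.mem_map.1 hy
      exact hx i) (δ.projWord ((w.drop r).take s) :: w.drop (r + s))
    have h2 : ((List.range r).map fun i => (p i, (x i : A))).map Prod.snd = w.take r := by
      rw [hw, ← List.map_take, List.take_range, min_eq_left (by omega), List.map_map]
      rfl
    have h3 : wordDegree ((List.range r).map fun i => (p i, (x i : A))) =
        ∑ i ∈ Finset.range r, p i := by
      rw [wordDegree, List.map_map, Finset.sum_range, ← List.sum_ofFn, List.ofFn_eq_map,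
        ← List.map_coe_finRange_eq_range, List.map_map]
      rfl
    rw [h2, h3, List.length_map, List.length_range] at h1
    exact h1
  rw [Submodule.coe_smul, hm, hBeq, projWord_smul_letter, hθ, smul_smul, smul_smul, smul_smul,
    ← zpow_add₀ (by simp), ← zpow_add₀ (by simp), ← zpow_add₀ (by simp)]
  congr 1
  apply neg_one_zpow_eq_of_even_sub
  have e1 : ps = ps.take r ++ ((ps.drop r).take s ++ ps.drop (r + s)) := by
    conv_lhs => rw [← List.take_append_drop r ps, ← List.take_append_drop s (ps.drop r),
      List.drop_drop]
  have e2 : (ps.take r).sum = ∑ i ∈ Finset.range r, p i := by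
    rw [hps, ← List.map_take, List.take_range, min_eq_left (by omega), Finset.sum_range,
      ← List.sum_ofFn, List.ofFn_eq_map, ← List.map_coe_finRange_eq_range, List.map_map]
    rfl
  have e3 : ((ps.drop r).take s).sum = ∑ a : Fin s, p (r + a) := by
    rw [hps, ← ofFn_segment p hrs, List.sum_ofFn]
  have l1 : ((ps.drop r).take s).length = s := by simp [hps]; omega
  obtain ⟨t, rfl⟩ : ∃ t, N = r + s + t := ⟨N - r - s, by omega⟩
  have l2 : (ps.drop (r + s)).length = t := by simp [hps]
  have e4 : signExp ps = signExp (ps.take r) + (signExp ((ps.drop r).take s) +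
      signExp (ps.drop (r + s)) + t * ∑ a : Fin s, p (r + a)) +
      (s + t) * ∑ i ∈ Finset.range r, p i := by
    conv_lhs => rw [e1]
    rw [signExp_append, signExp_append, List.length_append, l1, l2, e2, e3]
    push_cast
    ring
  rw [e4, signExp_append, signExp, List.length_cons, l2, e2, hq]
  push_cast
  generalize ∑ i ∈ Finset.range r, p i = U
  generalize ∑ a : Fin s, p (r + a) = V
  refine ⟨t, ?_⟩
  ring

open Classical in
theorem m_shuffle (a b : ℕ) (ha : 1 ≤ a) (hb : 1 ≤ b) (p : Fin (a + b) → ℤ)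
    (x : Fin (a + b) → δ.harmonic) (hx : ∀ i, x i ∈ δ.harmonicGrading (p i)) :
    ∑ σ ∈ Finset.univ.filter (fun σ : Equiv.Perm (Fin (a + b)) => IsShuffle a b σ),
      shuffleSign F p σ • δ.m (a + b) (fun i => x (σ.symm i)) = 0 := by
  apply Subtype.val_injective
  rw [AddSubmonoidClass.coe_finsetSum, ZeroMemClass.coe_zero]
  set z : Fin (a + b) → ℤ × A := fun i => (p i, (x i : A)) with hz
  have hhom : IsHomogeneousWord 𝒜 (List.ofFn z) := isHomogeneousWord_ofFn hx
  have h := sum_isCutShuffle (fun q r : ℤ × A => (-1 : F) ^ (1 + q.1 * r.1)) a (by omega) z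
    (fun l => (-1 : F) ^ signExp (l.map Prod.fst) • δ.projWord (l.map Prod.snd))
  have hproj : ∀ u v, shuffleSum (shiftedSign F) (fun l => δ.projWord (l.map Prod.snd)) u v =
      δ.proj (shuffleSum (shiftedSign F) (fun l => δ.hatWord (l.map Prod.snd)) u v) := fun u v =>
    (map_shuffleSum δ.proj _ _ u v).symm
  rw [shuffleSum_signExp (fun l : List (ℤ × A) => δ.projWord (l.map Prod.snd)), hproj,
    δ.shuffleSum_hatWord, map_zero, smul_zero] at h
  · rw [← h]
    simp only [isShuffle_iff_isCutShuffle]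
    refine Finset.sum_congr rfl fun σ _ => ?_
    rw [Submodule.coe_smul, δ.coe_m_eq (a + b) (fun i => p (σ.symm i)) _ fun i => hx _,
      List.map_ofFn, List.map_ofFn]
    rfl
  · exact List.ne_nil_of_length_pos (by simp; omega)
  · exact List.ne_nil_of_length_pos (by simp; omega)
  · exact fun q hq => hhom q (List.mem_of_mem_take hq)
  · exact fun q hq => hhom q (List.mem_of_mem_drop hq)

theorem isMinimalCInfinityAlgebra : IsMinimalCInfinityAlgebra δ.harmonicGrading δ.m where
  internal := δ.isInternal_harmonicGrading
  m_zero := δ.m_zero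
  degree := δ.m_mem
  relation := δ.m_relation
  shuffle := δ.m_shuffle
  m_one := δ.m_one

/-! ### The unit -/

theorem dm_one : δ.dm 1 = 0 := by
  have h := δ.dm_mem 0 1 (SetLike.one_mem_graded 𝒜)
  rwa [P.bounded _ (Or.inl (by omega)), Submodule.mem_bot] at h

theorem d_one : P.d 1 = 0 := by
  have h := P.leibniz 0 1 1 (SetLike.one_mem_graded 𝒜)
  simpa using h

theorem one_mem_harmonic : (1 : A) ∈ δ.harmonic :=
  ⟨1, by rw [proj_apply, dm_one, d_one, map_zero, map_zero, add_zero, sub_zero]⟩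

theorem signTwist_one (𝒜 : ℤ → Submodule F A) [GradedAlgebra 𝒜] (e : ℤ) :
    signTwist 𝒜 e 1 = 1 := by
  rw [signTwist_apply 𝒜 e 0 1 (SetLike.one_mem_graded 𝒜)]
  simp

/-- General e is needed because the recursion for `hat` twists the arguments of its middle terms by
an exponent that varies with the term. The twisted arguments must still be killed by d⁻. -/
theorem dm_signTwist_general (e : ℤ) (x : A) :
    (-1 : F) ^ e • δ.dm (signTwist 𝒜 e x) = signTwist 𝒜 e (δ.dm x) := by
  induction x using DirectSum.Decomposition.inductionOn 𝒜 with
  | zero => simp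
  | @homogeneous i m =>
    rw [signTwist_apply 𝒜 e i _ m.2, signTwist_apply 𝒜 e _ _ (δ.dm_mem _ _ m.2), map_smul,
      smul_smul, ← zpow_add₀ (by simp)]
    congr 1
    exact neg_one_zpow_eq_of_even_sub ⟨e, by ring⟩
  | add a b ha hb => rw [map_add, map_add, smul_add, ha, hb, map_add, map_add]

theorem dm_signTwist_eq_zero (e : ℤ) {x : A} (hx : δ.dm x = 0) :
    δ.dm (signTwist 𝒜 e x) = 0 := by
  have h := δ.dm_signTwist_general e x
  rw [hx, map_zero, smul_eq_zero] at h
  exact h.resolve_left (zpow_ne_zero _ (by simp))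

/-- Any linear map that kills `d⁻ A` kills the operations of arity at least three on arguments one
of which is the unit, if `d⁻` does so for the operations of smaller arity. -/
theorem map_hat_of_exists_eq_one {M : Type*} [AddCommGroup M] [Module F M] (φ : A →ₗ[F] M)
    (hφ : ∀ x, φ (δ.dm x) = 0) (k : ℕ) (x : Fin (k + 3) → A) (hx : ∀ i, δ.dm (x i) = 0)
    (h1 : ∃ i, x i = 1)
    (ih : ∀ l, 2 ≤ l → l < k + 3 → ∀ y : Fin l → A, (∀ i, δ.dm (y i) = 0) → (∃ i, y i = 1) →
      δ.dm (δ.hat l y) = 0) : φ (δ.hat (k + 3) x) = 0 := by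
  obtain ⟨j, hj⟩ := h1
  rw [hat]
  simp only [sub_apply, sum_apply, smul_apply, concat_apply, map_sub, map_sum, map_smul,
    LinearMap.compMultilinearMap_apply, MultilinearMap.compLinearMap_apply,
    MultilinearMap.ofSubsingleton_apply_apply, LinearMap.id_apply]
  have hfirst : φ (δ.dm (δ.hat (k + 2) fun i => x ⟨i, by omega⟩) * x ⟨k + 2 + (0 : Fin 1), by
      omega⟩) = 0 := by
    by_cases h : (j : ℕ) < k + 2
    · rw [ih (k + 2) (by omega) (by omega) (fun i => x ⟨i, by omega⟩) (fun i => hx _)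
        ⟨⟨j, h⟩, hj⟩, zero_mul, map_zero]
    · have e : (⟨k + 2 + ((0 : Fin 1) : ℕ), by omega⟩ : Fin (k + 3)) = j :=
        Fin.ext (by simp only [Fin.val_zero]; omega)
      rw [e, hj, mul_one, hφ]
  have hsecond : φ (signTwist 𝒜 (k + 3) (x ⟨(0 : Fin 1), by omega⟩) *
      δ.dm (δ.hat (k + 2) fun i => x ⟨1 + i, by omega⟩)) = 0 := by
    by_cases h : (j : ℕ) = 0
    · have e : (⟨((0 : Fin 1) : ℕ), by omega⟩ : Fin (k + 3)) = j :=
        Fin.ext (by simp only [Fin.val_zero]; omega)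
      rw [e, hj, signTwist_one, one_mul, hφ]
    · rw [ih (k + 2) (by omega) (by omega) _ (fun i => hx _) ⟨⟨j - 1, by omega⟩, by
        rw [← hj]; congr 1; ext; simp only; omega⟩, mul_zero, map_zero]
  -- Both factors have arity at least two, so whichever contains the unit vanishes by the inductive
  -- hypothesis.
  have hmid : ∀ i : Fin k, φ (δ.dm (δ.hat (i + 2) fun l =>
        signTwist 𝒜 ((k : ℤ) - i) (x ⟨l, by omega⟩)) *
      δ.dm (δ.hat (k + 1 - i) fun l => x ⟨i + 2 + l, by omega⟩)) = 0 := by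
    intro i
    by_cases h : (j : ℕ) < i + 2
    · rw [ih (i + 2) (by omega) (by omega) _ (fun l => δ.dm_signTwist_eq_zero _ (hx _))
        ⟨⟨j, h⟩, by rw [← signTwist_one 𝒜 ((k : ℤ) - i), ← hj]⟩, zero_mul, map_zero]
    · rw [ih (k + 1 - i) (by omega) (by omega) _ (fun i => hx _)
        ⟨⟨j - (i + 2), by omega⟩, by rw [← hj]; congr 1; ext; simp only; omega⟩, mul_zero, map_zero]
  rw [hfirst, hsecond, Finset.sum_eq_zero fun i _ => by rw [hmid i, smul_zero]]
  simp

/-- In arity two the product is the other argument, which d⁻ kills. In higher arity the preceding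
lemma applies to d⁻ itself, since d⁻d⁻ = 0. -/
theorem dm_hat_of_exists_eq_one (k : ℕ) (hk : 2 ≤ k) (x : Fin k → A) (hx : ∀ i, δ.dm (x i) = 0)
    (h1 : ∃ i, x i = 1) : δ.dm (δ.hat k x) = 0 := by
  induction k using Nat.strong_induction_on with
  | _ k ih =>
    match k, hk with
    | 2, _ =>
      obtain ⟨i, hi⟩ := h1
      rw [hat_two]
      fin_cases i
      · simp only [Fin.zero_eta] at hi
        rw [hi, one_mul, hx]
      · simp only [Fin.mk_one] at hi
        rw [hi, mul_one, hx]
    | k + 3, _ =>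
      exact δ.map_hat_of_exists_eq_one δ.dm δ.dm_dm k x hx h1 (fun l hl hl' y => ih l hl' hl y)

theorem isStrictUnit :
    IsStrictUnit δ.harmonicGrading δ.m ⟨1, δ.one_mem_harmonic⟩ where
  mem := SetLike.one_mem_graded 𝒜
  m_one := by rw [δ.m_one]; rfl
  left_unit a := Subtype.ext (by rw [coe_m, hat_two]; simp [proj_harmonic])
  right_unit a := Subtype.ext (by rw [coe_m, hat_two]; simp [proj_harmonic])
  higher k hk x h := by
    obtain ⟨k, rfl⟩ : ∃ l, k = l + 3 := ⟨k - 3, by omega⟩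
    obtain ⟨i, hi⟩ := h
    exact Subtype.ext (δ.map_hat_of_exists_eq_one δ.proj δ.proj_dm k _
      (fun i => δ.dm_harmonic _) ⟨i, congrArg Subtype.val hi⟩
      fun l hl _ y => δ.dm_hat_of_exists_eq_one l hl y)

/-! ### The cyclic pairing -/

theorem harmonicPairing_apply (x y : δ.harmonic) :
    δ.harmonicPairing x y = P.pairing x y := rfl

/-- A cocycle z is πz + d d⁻z, and x is closed, so by Stokes pairing x with z only sees πz. Hence
the class of x is orthogonal to all of cohomology, x is exact, and x = πx = 0. -/
theorem harmonicPairing_nondegenerate (x : δ.harmonic)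
    (hx : ∀ y, δ.harmonicPairing x y = 0) : x = 0 := by
  have hclass : P.coboundaries.mkQ ⟨x, δ.d_harmonic x⟩ = 0 := by
    refine P.nondegenerate _ fun β => ?_
    obtain ⟨z, rfl⟩ := P.coboundaries.mkQ_surjective β
    rw [DGCA.cup_mk, ← P.integral_cocycle]
    have hz : P.d (z : A) = 0 := z.2
    have h1 : P.integral (x * P.d (δ.dm z)) = 0 := by
      have h := P.integral_d (signTwist 𝒜 1 x * δ.dm z)
      rwa [P.d_signTwist_mul, P.d_signTwist, d_harmonic, map_zero, neg_zero, zero_mul,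
        zero_add] at h
    have h2 : P.integral (x * δ.proj z) = 0 := hx ⟨δ.proj z, _, rfl⟩
    have h3 : (P.cocycleMul ⟨x, δ.d_harmonic x⟩ z : A) = x * δ.proj z + x * P.d (δ.dm z) := by
      have h := δ.eq_hodge (z : A)
      rw [hz, map_zero, add_zero] at h
      rw [← mul_add, ← h]
      rfl
    rw [h3, map_add, h1, h2, add_zero]
  rw [Submodule.mkQ_apply, Submodule.Quotient.mk_eq_zero] at hclass
  obtain ⟨y, hy⟩ := hclass
  have hy : P.d y = x := hy
  exact Subtype.ext (by rw [← δ.proj_harmonic x, ← hy, proj_d]; rfl)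

theorem harmonicPairing_cyclic (k : ℕ) (p : Fin (k + 1) → ℤ) (x : Fin (k + 1) → δ.harmonic)
    (hx : ∀ i, x i ∈ δ.harmonicGrading (p i)) :
    δ.harmonicPairing (δ.m k fun i => x i.castSucc) (x (Fin.last k)) =
      (-1 : F) ^ k * (-1 : F) ^ (p 0 * ∑ i : Fin k, p i.succ) *
        δ.harmonicPairing (δ.m k fun i => x i.succ) (x 0) := by
  match k with
  | 0 => simp [m_zero]
  | k + 1 =>
    set w : List (ℤ × A) := List.ofFn fun i : Fin k => (p i.succ.castSucc, (x i.succ.castSucc : A))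
      with hw
    set y : ℤ × A := (p (Fin.last (k + 1)), (x (Fin.last (k + 1)) : A)) with hy
    have hwhom : IsHomogeneousWord 𝒜 w := isHomogeneousWord_ofFn fun i => hx _
    have hw1 : IsHomogeneousWord 𝒜 ((p 0, (x 0 : A)) :: w) := by
      intro q hq
      rcases List.mem_cons.1 hq with rfl | hq
      · exact hx 0
      · exact hwhom q hq
    have hw2 : IsHomogeneousWord 𝒜 (w ++ [y]) := by
      intro q hq
      rcases List.mem_append.1 hq with hq | hq
      · exact hwhom q hq
      · rw [List.mem_singleton.1 hq]
        exact hx _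
    have hlen : w.length = k := by simp [hw]
    have hleft : (δ.m (k + 1) (fun i => x i.castSucc) : A) =
        (-1 : F) ^ signExp (p 0 :: w.map Prod.fst) •
          δ.proj (δ.hatWord ((x 0 : A) :: w.map Prod.snd)) := by
      rw [δ.coe_m_eq (k + 1) (fun i => p i.castSucc) _ fun i => hx _, hw, List.map_ofFn,
        List.map_ofFn, List.ofFn_succ, List.ofFn_succ]
      rfl
    have hright : (δ.m (k + 1) (fun i => x i.succ) : A) =
        (-1 : F) ^ signExp (w.map Prod.fst ++ [y.1]) •
          δ.proj (δ.hatWord (w.map Prod.snd ++ [y.2])) := by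
      rw [δ.coe_m_eq (k + 1) (fun i => p i.succ) _ fun i => hx _, hw, List.map_ofFn,
        List.map_ofFn, List.ofFn_succ', List.ofFn_succ', List.concat_eq_append,
        List.concat_eq_append]
      rfl
    have hsum : ∑ i : Fin (k + 1), p i.succ = wordDegree w + y.1 := by
      rw [Fin.sum_univ_castSucc, hw, wordDegree_ofFn]
      rfl
    have hd1 := δ.hatWord_mem hw1
    have hd2 := δ.hatWord_mem hw2
    rw [List.map_cons] at hd1
    rw [List.map_append, List.map_cons, List.map_nil] at hd2
    -- The sign-free identity has `x 0` on the left of the pairing; graded symmetry moves it to the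
    -- right, as the statement requires.
    have hcyc := δ.pairing_hatWord_cyclic (x 0 : A) y.2 (w.map Prod.snd)
    have hsymm : P.pairing (x 0 : A) (δ.hatWord (w.map Prod.snd ++ [y.2])) = _ :=
      P.pairing_symm (hx 0) hd2
    rw [signTwist_one_apply 𝒜 hd1, hsymm, map_smul, LinearMap.smul_apply, smul_eq_mul] at hcyc
    have hinv : ∀ e : ℤ, (-1 : F) ^ e * (-1 : F) ^ e = 1 := fun e => by
      rw [← mul_zpow]
      simp
    -- The projection π drops out because the other argument of each pairing is harmonic.
    rw [harmonicPairing_apply, harmonicPairing_apply, hleft, hright, map_smul, map_smul,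
      LinearMap.smul_apply, LinearMap.smul_apply, smul_eq_mul, smul_eq_mul,
      δ.pairing_proj_left _ _ (x 0).2, δ.pairing_proj_left _ _ (x (Fin.last (k + 1))).2]
    have hcyc' := congrArg (fun c => (-1 : F) ^ (wordDegree ((p 0, (x 0 : A)) :: w) + 2 -
      (((p 0, (x 0 : A)) :: w).length : ℤ)) * c) hcyc
    simp only [← mul_assoc, hinv, one_mul] at hcyc'
    refine (congrArg _ hcyc'.symm).trans ?_
    rw [hsum, ← zpow_natCast, ← mul_assoc, ← mul_assoc, ← mul_assoc, ← zpow_add₀ (by simp),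
      ← zpow_add₀ (by simp), ← zpow_add₀ (by simp), ← zpow_add₀ (by simp)]
    congr 1
    apply neg_one_zpow_eq_of_even_sub
    simp only [signExp, signExp_append, wordDegree, List.map_append, List.map_cons, List.map_nil,
      List.sum_append, List.sum_cons, List.sum_nil, List.length_append, List.length_cons,
      List.length_nil, List.length_map, hlen]
    push_cast
    refine ⟨p 0 - k, ?_⟩
    ring

theorem isCyclic : IsCyclic δ.harmonicGrading δ.m δ.harmonicPairing n where
  degree _ _ _ _ hx hy hpq := P.pairing_of_mem hpq hx hy
  symm _ _ _ _ hx hy := P.pairing_symm hx hy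
  nondegenerate := δ.harmonicPairing_nondegenerate
  cyclic := δ.harmonicPairing_cyclic

end HodgeHomotopy

end DGCA

end HodgeTransfer

theorem theorem3p2 {F : Type*} [Field F] {A : Type*} [Ring A] [Algebra F A]
    (𝒜 : ℤ → Submodule F A) [GradedAlgebra 𝒜] (n : ℕ)
    (P : HodgeTransfer.PDGCA 𝒜 n) (δ : HodgeTransfer.HodgeHomotopy P) :
    HodgeTransfer.IsMinimalCInfinityAlgebra δ.harmonicGrading δ.m ∧
      (∃ e : δ.harmonic, (e : A) = 1 ∧ HodgeTransfer.IsStrictUnit δ.harmonicGrading δ.m e) ∧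
      HodgeTransfer.IsCyclic δ.harmonicGrading δ.m δ.harmonicPairing n :=
  ⟨δ.isMinimalCInfinityAlgebra, ⟨⟨1, δ.one_mem_harmonic⟩, rfl, δ.isStrictUnit⟩, δ.isCyclic⟩
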